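/- For a domain $D\subset\mathbb C$, let $\mathcal D(D)$ be the reduced Bergman space: the holomorphic functions $h$ on $D$ with $\int_D|h|^2\,dA<\infty$ that have a holomorphic primitive on $D$. With the inner product $\langle h,k\rangle=\int_D h\bar k\,dA$ it has a reproducing kernel, the reduced Bergman kernel $\tilde K_D(z,\zeta)$: $\tilde K_D(\cdot,\zeta)\in\mathcal D(D)$ and $h(\zeta)=\int_D h(z)\overline{\tilde K_D(z,\zeta)}\,dA(z)$ for all $h\in\mathcal D(D)$, $\zeta\in D$. Let $D_1,D_2\subset\mathbb C$ be bounded domains and let $f:D_1\multimap D_2$ be a proper holomorphic correspondence, that is, $f(z)=\{w:(z,w)\in V\}$ for a complex subvariety $V$ of $D_1\times D_2$ whose projections $V\to D_1$ and $V\to D_2$ are proper. Write $f^{-1}(w)=\{z:(z,w)\in V\}$ and $\tilde K_j=\tilde K_{D_j}$. **Theorem 1.2.** (a) The kernels $\tilde K_1,\tilde K_2$ exist, and there are relatively closed discrete subsets $V_1\subset D_1$, $V_2\subset D_2$ and integers $p,q\ge 0$ such that every $z_0\in D_1\setminus V_1$ has a neighbourhood on which $f(z)=\{f_1(z),\dots,f_p(z)\}$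 with $p$ holomorphic functions $f_i$ having pairwise distinct germs at $z_0$, and every $w_0\in D_2\setminus V_2$ has a neighbourhood on which $f^{-1}(w)=\{F_1(w),\dots,F_q(w)\}$ with $q$ holomorphic functions $F_j$ having pairwise distinct germs at $w_0$. (b) For all such $V_1,V_2,p,q$ we have: $p$ and $q$ are positive unless $V$ is a discrete set, and $$\sum_{i=1}^p f_i'(z)\,\tilde K_2(f_i(z),w)=\sum_{j=1}^q\tilde K_1(z,F_j(w))\,\overline{F_j'(w)}\qquad\text{for all }z\in D_1,\ w\in D_2,$$ where the two sides are understood by continuous extension at points $z\in V_1$, respectively $w\in V_2$. Precisely: there is a continuous function $H$ on $D_1\times D_2$, holomorphic in $z$ and antiholomorphic in $w$, that equals the left side for all $z\in D_1\setminus V_1$, $w\in D_2$ and equals the right side for all $z\in D_1$, $w\in D_2\setminus V_2$, for every choice of the local branches $f_i$ at $z$ and $F_j$ at $w$. -/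

import Mathlib

open Set Filter Topology MeasureTheory ComplexConjugate

/-- A domain in `ℂ`: a nonempty connected open set. -/
def IsPlanarDomain (D : Set ℂ) : Prop := IsOpen D ∧ IsConnected D

/-- The reduced Bergman space of `D`: holomorphic functions on `D` that have a holomorphic
primitive on `D` and are square integrable for area measure.  (Only values on `D` matter.) -/
def reducedBergmanSpace (D : Set ℂ) : Set (ℂ → ℂ) :=
  {f | DifferentiableOn ℂ f D ∧
    (∃ g : ℂ → ℂ, DifferentiableOn ℂ g D ∧ ∀ z ∈ D, HasDerivAt g (f z) z) ∧
    IntegrableOn (fun z => ‖f z‖ ^ 2) D volume}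

/-- `K` is the reproducing kernel of the reduced Bergman space of `D`. This determines `K` on
`D × D`. -/
def IsReducedBergmanKernel (D : Set ℂ) (K : ℂ → ℂ → ℂ) : Prop :=
  ∀ ζ ∈ D, (fun z => K z ζ) ∈ reducedBergmanSpace D ∧
    ∀ f ∈ reducedBergmanSpace D, f ζ = ∫ z in D, f z * conj (K z ζ)

open Classical in
/-- The reduced Bergman kernel of `D`: the reproducing kernel of the reduced Bergman space. -/
noncomputable def reducedBergmanKernel (D : Set ℂ) : ℂ → ℂ → ℂ :=
  if h : ∃ K, IsReducedBergmanKernel D K then h.choose else fun _ _ => 0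

/-- `V` is a complex subvariety of the open set `Ω ⊆ ℂ²`: near every point of `Ω`, it is the
common zero set of finitely many holomorphic functions. -/
def IsComplexSubvariety (Ω V : Set (ℂ × ℂ)) : Prop :=
  V ⊆ Ω ∧ ∀ x ∈ Ω, ∃ U : Set (ℂ × ℂ), IsOpen U ∧ x ∈ U ∧ U ⊆ Ω ∧
    ∃ (n : ℕ) (g : Fin n → ℂ × ℂ → ℂ), (∀ i, DifferentiableOn ℂ (g i) U) ∧
      V ∩ U = {y ∈ U | ∀ i, g i y = 0}

/-- `V` is the graph of a proper holomorphic correspondence `D₁ ⊸ D₂`: a complex subvariety of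
`D₁ × D₂` whose projections to `D₁` and to `D₂` are both proper, that is, preimages in `V` of
compact sets are compact. -/
def IsProperHolomorphicCorrespondence (D₁ D₂ : Set ℂ) (V : Set (ℂ × ℂ)) : Prop :=
  IsComplexSubvariety (D₁ ×ˢ D₂) V ∧
    (∀ K ⊆ D₁, IsCompact K → IsCompact (V ∩ Prod.fst ⁻¹' K)) ∧
    (∀ K ⊆ D₂, IsCompact K → IsCompact (V ∩ Prod.snd ⁻¹' K))

/-- The multivalued function `f(z) = π₂ π₁⁻¹(z)` with graph `V`. -/
def corrMap (V : Set (ℂ × ℂ)) (z : ℂ) : Set ℂ := {w | (z, w) ∈ V}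

/-- The inverse multivalued function `π₁ π₂⁻¹` of the one with graph `V`. -/
def corrInv (V : Set (ℂ × ℂ)) (w : ℂ) : Set ℂ := {z | (z, w) ∈ V}

/-- Near `a`, the multivalued function `Φ` is given by the `n` holomorphic functions
`f 0, …, f (n - 1)`, which are pairwise distinct as germs at `a`. -/
def IsLocalBranches (Φ : ℂ → Set ℂ) (a : ℂ) {n : ℕ} (f : Fin n → ℂ → ℂ) : Prop :=
  (∀ i, AnalyticAt ℂ (f i) a) ∧
    (∀ᶠ z in 𝓝 a, Φ z = range fun i => f i z) ∧
    ∀ i j, i ≠ j → ¬ (f i =ᶠ[𝓝 a] f j)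

/-- `S` is a discrete, relatively closed subset of `D`, and on `D \ S` the multivalued function
`Φ` is locally given by `n` holomorphic functions. -/
def HasBranchesOff (D : Set ℂ) (Φ : ℂ → Set ℂ) (S : Set ℂ) (n : ℕ) : Prop :=
  S ⊆ D ∧ (∀ a ∈ D, ∀ᶠ z in 𝓝[≠] a, z ∉ S) ∧
    ∀ a ∈ D \ S, ∃ f : Fin n → ℂ → ℂ, IsLocalBranches Φ a f

/-!
Let `p` and `q` be the numbers of branches `f i` of the correspondence and `F j` of its inverse.
The *transfer* of a function `h` on `D₂` is `Λ h = ∑ i, f i' · (h ∘ f i)`, which does not depend on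
the numbering of the branches (`IsTransfer`); the inverse correspondence defines a transfer `Λ'` in
the other direction. The formula says that `Λ` and `Λ'` are adjoint to each other, applied to
reproducing kernels: `⟨Λ K₂(·, w), K₁(·, z)⟩ = ⟨K₂(·, w), Λ' K₁(·, z)⟩` reads
`(Λ K₂(·, w))(z) = conj ((Λ' K₁(·, z))(w))`, and Hermitian symmetry of the kernels turns the right
side into the sum over the `F j`.

*The transfer acts on the reduced Bergman spaces.* If `g` is a primitive of `h`, then `∑ i, g ∘ f i`
is a primitive of `Λ h` off the exceptional set. It stays bounded near exceptional points because
the correspondence is proper, so it extends holomorphically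
(`exists_differentiableOn_deriv_eq_sum`). This is where primitives are used: the boundedness of
`∑ i, f i' · (h ∘ f i)` itself is not clear, as the `f i'` may blow up.

*Adjointness.* Off a countable set of fibres, `V` is covered by countably many biholomorphic patches
(`IsPatch`), on each of which `V` is the graph of a biholomorphic map `e`. Cutting them into disjoint
pieces, almost every point of `D₁` is in exactly `p` pieces and almost every point of `D₂` in exactly
`q` images of pieces (`IsPatchSequence.exists_index`). The change of variables `w = e z` on each
piece gives the `L²` bound `‖Λ h‖² ≤ p q ‖h‖²` (`IsTransfer.lintegral_enorm_sq_le`) and the adjointness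
(`IsTransfer.integral_mul_conj_eq`).

*Regularity.* The resulting function `H(z, w)` is holomorphic in `z` and antiholomorphic in `w`. Point
evaluations and the `L²` bound make it locally bounded, and Cauchy's estimate then makes it jointly
continuous (`exists_continuousOn_transfer_kernel`).

*Kernels.* Point evaluations are bounded for the `L²` norm, and a locally uniform limit of functions
with primitives has a primitive, so the reduced Bergman space is complete and Riesz representation
gives the kernel (`exists_isReducedBergmanKernel`).

*Branches.* Fibres are finite by the identity theorem and compactness. Near a point of `V`, some
defining function `g` has finitely many zeros `w` over each `z`, and contour integrals express the
sums of `μ(w) ψ(z, w) w ^ k` over these zeros, with `μ(w)` the multiplicity, as holomorphic functions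
of `z`. The Hankel determinant of these sums is nonzero exactly when the number of zeros with `ψ ≠ 0`
attains its maximum (`det_hankel_ne_zero_iff`), so for every `ψ` this number is constant over a
punctured neighbourhood. Taking for `ψ` the constant `1` and the other defining functions, one finds
that the common zeros are holomorphic functions of `z` there
(`eventually_exists_branches_commonZeros`), without Weierstrass preparation. The number of branches
is constant since a connected open set stays connected, locally, when a point is removed
(`IsProperHolomorphicCorrespondence.exists_hasBranchesOff`).
-/

/-! ### Holomorphic dependence on parameters -/

theorem differentiableOn_intervalIntegral_of_continuousOn {Φ : ℂ → ℝ → ℂ} {B : Set ℂ}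
    (hB : IsOpen B) (a b : ℝ) (hc : ContinuousOn (Function.uncurry Φ) (B ×ˢ univ))
    (hd : ∀ t, DifferentiableOn ℂ (fun z => Φ z t) B) :
    DifferentiableOn ℂ (fun z => ∫ t in a..b, Φ z t) B := by
  intro z₀ hz₀
  obtain ⟨ε, hε, hεB⟩ := Metric.nhds_basis_closedBall.mem_iff.1 (hB.mem_nhds hz₀)
  have hcont : ∀ z ∈ B, Continuous (Φ z) := fun z hz => by
    rw [← continuousOn_univ]
    exact hc.comp (f := fun t : ℝ => (z, t)) (by fun_prop) (fun t _ => ⟨hz, trivial⟩)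
  obtain ⟨M, hM⟩ := ((isCompact_closedBall z₀ ε).prod (isCompact_uIcc (a := a) (b := b))
    ).exists_bound_of_continuousOn (hc.mono (prod_mono hεB (subset_univ _)))
  have hball : ∀ x ∈ Metric.ball z₀ (ε / 2), Metric.closedBall x (ε / 2) ⊆ Metric.closedBall z₀ ε := by
    intro x hx
    apply Metric.closedBall_subset_closedBall'
    rw [Metric.mem_ball] at hx
    linarith
  have hda : ∀ t, ∀ x ∈ B, HasDerivAt (fun z => Φ z t) (deriv (fun z => Φ z t) x) x :=
    fun t x hx => ((hd t).differentiableAt (hB.mem_nhds hx)).hasDerivAt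
  have key := intervalIntegral.hasDerivAt_integral_of_dominated_loc_of_deriv_le
    (μ := volume) (a := a) (b := b) (F := Φ) (F' := fun z t => deriv (fun z => Φ z t) z)
    (bound := fun _ => M / (ε / 2)) (x₀ := z₀)
    (Metric.ball_mem_nhds z₀ (half_pos hε)) ?_ ?_ ?_ ?_ ?_ ?_
  · exact key.2.differentiableAt.differentiableWithinAt
  · filter_upwards [hB.mem_nhds hz₀] with z hz
    exact (hcont z hz).aestronglyMeasurable
  · exact (hcont z₀ hz₀).intervalIntegrable _ _
  · -- the derivative is a pointwise limit of difference quotients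
    let u : ℕ → ℂ := fun n => ((n : ℂ) + 1)⁻¹
    have hu : Tendsto u atTop (𝓝[≠] 0) := by
      rw [tendsto_nhdsWithin_iff]
      refine ⟨?_, Eventually.of_forall fun n => inv_ne_zero (Nat.cast_add_one_ne_zero n)⟩
      have := tendsto_one_div_add_atTop_nhds_zero_nat (𝕜 := ℂ)
      simpa [u, one_div] using this
    have hu0 : Tendsto (fun n => z₀ + u n) atTop (𝓝 z₀) := by
      simpa using tendsto_const_nhds.add (hu.mono_right nhdsWithin_le_nhds)
    obtain ⟨N, hN⟩ := eventually_atTop.1 (hu0.eventually (hB.mem_nhds hz₀))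
    refine aestronglyMeasurable_of_tendsto_ae atTop
      (f := fun n t => (u (n + N))⁻¹ • (Φ (z₀ + u (n + N)) t - Φ z₀ t)) (fun n => ?_) ?_
    · have h1 := hcont _ (hN (n + N) (Nat.le_add_left N n))
      have h2 := hcont z₀ hz₀
      have h3 : Continuous fun t => (u (n + N))⁻¹ • (Φ (z₀ + u (n + N)) t - Φ z₀ t) := by fun_prop
      exact h3.aestronglyMeasurable
    · refine Eventually.of_forall fun t => ?_
      exact ((hda t z₀ hz₀).tendsto_slope_zero).comp (hu.comp (tendsto_add_atTop_nat N))
  · refine Eventually.of_forall fun t ht x hx => ?_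
    refine Complex.norm_deriv_le_of_forall_mem_sphere_norm_le (half_pos hε) ?_ ?_
    · exact (hd t).diffContOnCl_ball ((hball x hx).trans hεB)
    · intro y hy
      exact hM (y, t) ⟨hball x hx (Metric.sphere_subset_closedBall hy), uIoc_subset_uIcc ht⟩
  · exact intervalIntegrable_const
  · refine Eventually.of_forall fun t _ x hx => hda t x (hεB ?_)
    exact Metric.ball_subset_closedBall (Metric.ball_subset_ball (half_le_self hε.le) hx)

theorem differentiableOn_circleIntegral_of_continuousOn {F : ℂ → ℂ → ℂ} {B : Set ℂ}
    (hB : IsOpen B) {c : ℂ} {r : ℝ} (hr : 0 ≤ r)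
    (hc : ContinuousOn (Function.uncurry F) (B ×ˢ Metric.sphere c r))
    (hd : ∀ w ∈ Metric.sphere c r, DifferentiableOn ℂ (fun z => F z w) B) :
    DifferentiableOn ℂ (fun z => ∮ w in C(c, r), F z w) B := by
  refine differentiableOn_intervalIntegral_of_continuousOn hB _ _ ?_ fun t => ?_
  · have h1 : Continuous fun x : ℂ × ℝ => deriv (circleMap c r) x.2 := by
      simp only [deriv_circleMap]; fun_prop
    have h2 : ContinuousOn (fun x : ℂ × ℝ => F x.1 (circleMap c r x.2)) (B ×ˢ univ) :=
      hc.comp (f := fun x : ℂ × ℝ => (x.1, circleMap c r x.2))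
        (by fun_prop) fun x hx => ⟨hx.1, circleMap_mem_sphere c hr _⟩
    exact h1.continuousOn.mul h2
  · exact (hd _ (circleMap_mem_sphere c hr t)).const_mul _

/-- A locally bounded function of two variables that is holomorphic in the first variable and
continuous in the second is jointly continuous: Cauchy's estimate makes it Lipschitz in the
first variable, locally uniformly in the second. -/
theorem continuousOn_of_differentiableAt_of_continuousAt {Ω : Set (ℂ × ℂ)} (hΩ : IsOpen Ω)
    {F : ℂ × ℂ → ℂ} (h₁ : ∀ x ∈ Ω, DifferentiableAt ℂ (fun z => F (z, x.2)) x.1)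
    (h₂ : ∀ x ∈ Ω, ContinuousAt (fun w => F (x.1, w)) x.2)
    (hb : ∀ x ∈ Ω, ∃ M : ℝ, ∀ᶠ y in 𝓝 x, ‖F y‖ ≤ M) : ContinuousOn F Ω := by
  rintro ⟨z₀, w₀⟩ hx
  refine ContinuousAt.continuousWithinAt ?_
  obtain ⟨M, hM⟩ := hb _ hx
  obtain ⟨ε, hε, hεM⟩ := Metric.nhds_basis_closedBall.mem_iff.1
    (Filter.inter_mem hM (hΩ.mem_nhds hx))
  have hmem : ∀ z ∈ Metric.closedBall z₀ ε, ∀ w ∈ Metric.closedBall w₀ ε,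
      ‖F (z, w)‖ ≤ M ∧ (z, w) ∈ Ω := fun z hz w hw =>
    hεM (by rw [← closedBall_prod_same]; exact ⟨hz, hw⟩)
  have hlip : ∀ z ∈ Metric.ball z₀ (ε / 2), ∀ w ∈ Metric.ball w₀ (ε / 2),
      ‖F (z, w) - F (z₀, w)‖ ≤ M / (ε / 2) * ‖z - z₀‖ := by
    intro z hz w hw
    have hw' : w ∈ Metric.closedBall w₀ ε :=
      Metric.ball_subset_closedBall (Metric.ball_subset_ball (half_le_self hε.le) hw)
    refine (convex_ball z₀ (ε / 2)).norm_image_sub_le_of_norm_deriv_le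
      (f := fun z => F (z, w)) (fun x hx => ?_) (fun x hx => ?_)
      (Metric.mem_ball_self (half_pos hε)) hz
    · exact h₁ (x, w) (hmem x (Metric.ball_subset_closedBall
        (Metric.ball_subset_ball (half_le_self hε.le) hx)) w hw').2
    · have hsub : Metric.closedBall x (ε / 2) ⊆ Metric.closedBall z₀ ε := by
        apply Metric.closedBall_subset_closedBall'
        rw [Metric.mem_ball] at hx
        linarith
      refine Complex.norm_deriv_le_of_forall_mem_sphere_norm_le (half_pos hε) ?_ fun y hy =>
        (hmem y (hsub (Metric.sphere_subset_closedBall hy)) w hw').1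
      refine DifferentiableOn.diffContOnCl fun y hy => ?_
      rw [closure_ball _ (half_pos hε).ne'] at hy
      exact (h₁ (y, w) (hmem y (hsub hy) w hw').2).differentiableWithinAt
  have h0 : Tendsto (fun x : ℂ × ℂ => M / (ε / 2) * ‖x.1 - z₀‖ + ‖F (z₀, x.2) - F (z₀, w₀)‖)
      (𝓝 (z₀, w₀)) (𝓝 0) := by
    have e1 : Tendsto (fun x : ℂ × ℂ => M / (ε / 2) * ‖x.1 - z₀‖) (𝓝 (z₀, w₀)) (𝓝 0) := by
      have : Continuous (fun x : ℂ × ℂ => M / (ε / 2) * ‖x.1 - z₀‖) := by fun_prop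
      simpa using this.tendsto (z₀, w₀)
    have e2 : Tendsto (fun x : ℂ × ℂ => ‖F (z₀, x.2) - F (z₀, w₀)‖) (𝓝 (z₀, w₀)) (𝓝 0) := by
      have h3 : Tendsto (fun x : ℂ × ℂ => F (z₀, x.2)) (𝓝 (z₀, w₀)) (𝓝 (F (z₀, w₀))) :=
        (h₂ _ hx).tendsto.comp continuous_snd.continuousAt
      simpa using (h3.sub_const (F (z₀, w₀))).norm
    simpa using e1.add e2
  rw [ContinuousAt, tendsto_iff_norm_sub_tendsto_zero]
  refine squeeze_zero' (Eventually.of_forall fun _ => norm_nonneg _) ?_ h0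
  have hn : Metric.ball z₀ (ε / 2) ×ˢ Metric.ball w₀ (ε / 2) ∈ 𝓝 (z₀, w₀) :=
    prod_mem_nhds (Metric.ball_mem_nhds _ (half_pos hε)) (Metric.ball_mem_nhds _ (half_pos hε))
  filter_upwards [hn] with x hx
  calc ‖F x - F (z₀, w₀)‖ ≤ ‖F x - F (z₀, x.2)‖ + ‖F (z₀, x.2) - F (z₀, w₀)‖ :=
        norm_sub_le_norm_sub_add_norm_sub _ _ _
    _ ≤ _ := by gcongr; exact hlip x.1 hx.1 x.2 hx.2

theorem differentiableAt_slice_snd {Ω : Set (ℂ × ℂ)} (hΩ : IsOpen Ω) {g : ℂ × ℂ → ℂ}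
    (hg : DifferentiableOn ℂ g Ω) {z w : ℂ} (h : (z, w) ∈ Ω) :
    DifferentiableAt ℂ (fun w => g (z, w)) w :=
  (hg.differentiableAt (hΩ.mem_nhds h)).comp w
    ((differentiableAt_const z).prodMk differentiableAt_id)

theorem differentiableAt_slice_fst {Ω : Set (ℂ × ℂ)} (hΩ : IsOpen Ω) {g : ℂ × ℂ → ℂ}
    (hg : DifferentiableOn ℂ g Ω) {z w : ℂ} (h : (z, w) ∈ Ω) :
    DifferentiableAt ℂ (fun z => g (z, w)) z :=
  (hg.differentiableAt (hΩ.mem_nhds h)).comp (f := fun z => (z, w)) z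
    (differentiableAt_id.prodMk (differentiableAt_const w))

theorem isOpen_slice_snd {Ω : Set (ℂ × ℂ)} (hΩ : IsOpen Ω) (z : ℂ) :
    IsOpen {w | (z, w) ∈ Ω} := hΩ.preimage (by fun_prop)

theorem analyticAt_slice_snd {Ω : Set (ℂ × ℂ)} (hΩ : IsOpen Ω) {g : ℂ × ℂ → ℂ}
    (hg : DifferentiableOn ℂ g Ω) {z w : ℂ} (h : (z, w) ∈ Ω) :
    AnalyticAt ℂ (fun w => g (z, w)) w := by
  refine DifferentiableOn.analyticAt (s := {w | (z, w) ∈ Ω}) (fun w hw => ?_)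
    ((isOpen_slice_snd hΩ z).mem_nhds h)
  exact (differentiableAt_slice_snd hΩ hg hw).differentiableWithinAt

/-- The partial derivative of a holomorphic function of two variables in the second variable is
holomorphic in the first, by Cauchy's formula for the derivative. -/
theorem differentiableAt_partialDeriv_fst {Ω : Set (ℂ × ℂ)} (hΩ : IsOpen Ω) {g : ℂ × ℂ → ℂ}
    (hg : DifferentiableOn ℂ g Ω) {z₀ w₀ : ℂ} (h : (z₀, w₀) ∈ Ω) :
    DifferentiableAt ℂ (fun z => deriv (fun w => g (z, w)) w₀) z₀ := by
  obtain ⟨ε, hε, hεM⟩ := Metric.nhds_basis_closedBall.mem_iff.1 (hΩ.mem_nhds h)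
  have hmem : ∀ z ∈ Metric.closedBall z₀ ε, ∀ w ∈ Metric.closedBall w₀ ε, (z, w) ∈ Ω :=
    fun z hz w hw => hεM (by rw [← closedBall_prod_same]; exact ⟨hz, hw⟩)
  have hD : DifferentiableOn ℂ
      (fun z => ∮ w in C(w₀, ε), ((w - w₀) ^ 2)⁻¹ • g (z, w)) (Metric.ball z₀ ε) := by
    refine differentiableOn_circleIntegral_of_continuousOn Metric.isOpen_ball hε.le ?_ ?_
    · have h1 : ContinuousOn (fun x : ℂ × ℂ => (x.2 - w₀) ^ 2)
          (Metric.ball z₀ ε ×ˢ Metric.sphere w₀ ε) := by fun_prop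
      refine (h1.inv₀ ?_).mul (hg.continuousOn.mono ?_)
      · rintro ⟨z, w⟩ ⟨_, hw⟩
        simp only [Metric.mem_sphere, dist_eq_norm] at hw
        refine pow_ne_zero _ fun h0 => hε.ne' ?_
        change w - w₀ = 0 at h0
        rw [← hw, h0, norm_zero]
      · rintro ⟨z, w⟩ ⟨hz, hw⟩
        exact hmem z (Metric.ball_subset_closedBall hz) w (Metric.sphere_subset_closedBall hw)
    · intro w hw
      refine DifferentiableOn.const_mul (fun z hz => ?_) _
      exact (differentiableAt_slice_fst hΩ hg (hmem z (Metric.ball_subset_closedBall hz) w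
        (Metric.sphere_subset_closedBall hw))).differentiableWithinAt
  have hball := Metric.ball_mem_nhds z₀ hε
  refine ((hD.differentiableAt hball).const_smul ((2 * Real.pi * Complex.I : ℂ)⁻¹)).congr_of_eventuallyEq ?_
  filter_upwards [hball] with z hz
  exact (Complex.two_pi_I_inv_smul_circleIntegral_sub_sq_inv_smul_of_differentiable
    (isOpen_slice_snd hΩ z) (fun w hw => hmem z (Metric.ball_subset_closedBall hz) w hw)
    (fun w hw => (differentiableAt_slice_snd hΩ hg hw).differentiableWithinAt)
    (Metric.mem_ball_self hε)).symm

/-- The partial derivative in the second variable is jointly continuous: it is holomorphic in each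
variable separately, and locally bounded by Cauchy's estimate. -/
theorem continuousOn_partialDeriv_snd {Ω : Set (ℂ × ℂ)} (hΩ : IsOpen Ω) {g : ℂ × ℂ → ℂ}
    (hg : DifferentiableOn ℂ g Ω) :
    ContinuousOn (fun x : ℂ × ℂ => deriv (fun w => g (x.1, w)) x.2) Ω := by
  refine continuousOn_of_differentiableAt_of_continuousAt hΩ
    (fun x hx => differentiableAt_partialDeriv_fst hΩ hg hx)
    (fun x hx => (analyticAt_slice_snd hΩ hg hx).deriv.continuousAt) ?_
  rintro ⟨z₀, w₀⟩ h
  obtain ⟨ε, hε, hεM⟩ := Metric.nhds_basis_closedBall.mem_iff.1 (hΩ.mem_nhds h)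
  obtain ⟨M, hM⟩ := (isCompact_closedBall (z₀, w₀) ε).exists_bound_of_continuousOn
    (hg.continuousOn.mono hεM)
  refine ⟨M / (ε / 2), ?_⟩
  filter_upwards [Metric.ball_mem_nhds (z₀, w₀) (half_pos hε)] with x hx
  rw [← ball_prod_same] at hx
  have hmem : ∀ w ∈ Metric.closedBall x.2 (ε / 2), (x.1, w) ∈ Metric.closedBall (z₀, w₀) ε := by
    intro w hw
    rw [← closedBall_prod_same]
    refine ⟨Metric.ball_subset_closedBall (Metric.ball_subset_ball (half_le_self hε.le) hx.1), ?_⟩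
    have h1 := hx.2
    rw [Metric.mem_ball] at h1
    exact Metric.closedBall_subset_closedBall' (by linarith) hw
  refine Complex.norm_deriv_le_of_forall_mem_sphere_norm_le (half_pos hε) ?_ fun y hy =>
    hM _ (hmem y (Metric.sphere_subset_closedBall hy))
  refine DifferentiableOn.diffContOnCl fun y hy => ?_
  rw [closure_ball _ (half_pos hε).ne'] at hy
  exact (differentiableAt_slice_snd hΩ hg (hεM (hmem y hy))).differentiableWithinAt

/-! ### The argument principle with weights -/

theorem finite_zeros_closedBall {g : ℂ → ℂ} {c : ℂ} {r : ℝ} (hr : 0 < r)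
    (hg : AnalyticOnNhd ℂ g (Metric.closedBall c r)) (hs : ∀ w ∈ Metric.sphere c r, g w ≠ 0) :
    {w ∈ Metric.closedBall c r | g w = 0}.Finite := by
  by_contra hinf
  obtain ⟨x, hx, hacc⟩ := Set.Infinite.exists_accPt_of_subset_isCompact hinf
    (isCompact_closedBall c r) (fun w hw => hw.1)
  have hfreq : ∃ᶠ w in 𝓝[≠] x, g w = 0 :=
    (accPt_iff_frequently_nhdsNE.1 hacc).mono fun w hw => hw.2
  have hz := hg.eqOn_zero_of_preconnected_of_frequently_eq_zero
    (convex_closedBall c r).isPreconnected hx hfreq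
  obtain ⟨w, hw⟩ := NormedSpace.sphere_nonempty (x := c) (r := r) |>.2 hr.le
  exact hs w hw (hz (Metric.sphere_subset_closedBall hw))

/-- Dividing an analytic function by the factor `(w - a) ^ n` of its zero at `a`. -/
theorem exists_analyticOnNhd_pow_mul {g : ℂ → ℂ} {K : Set ℂ} (hg : AnalyticOnNhd ℂ g K) {a : ℂ}
    (ha : a ∈ K) (h0 : g a = 0) (hne : ¬ ∀ᶠ w in 𝓝 a, g w = 0) :
    ∃ (n : ℕ) (h : ℂ → ℂ), n ≠ 0 ∧ AnalyticOnNhd ℂ h K ∧ h a ≠ 0 ∧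
      ∀ w, g w = (w - a) ^ n * h w := by
  obtain ⟨n, h, hh, hha, heq⟩ := (hg a ha).exists_eventuallyEq_pow_smul_nonzero_iff.2 hne
  have hn : n ≠ 0 := by
    rintro rfl
    have := heq.self_of_nhds
    simp [h0] at this
    exact hha this.symm
  let k : ℂ → ℂ := Function.update (fun w => g w / (w - a) ^ n) a (h a)
  have hka : k a = h a := Function.update_self ..
  have hkw : ∀ w, w ≠ a → k w = g w / (w - a) ^ n := fun w hw => Function.update_of_ne hw ..
  refine ⟨n, k, hn, fun w hw => ?_, by rwa [hka], fun w => ?_⟩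
  · by_cases hwa : w = a
    · subst hwa
      refine hh.congr ?_
      filter_upwards [heq] with x hx
      by_cases hxw : x = w
      · rw [hxw, hka]
      · have : (x - w) ^ n ≠ 0 := pow_ne_zero _ (sub_ne_zero.2 hxw)
        rw [hkw x hxw, hx, smul_eq_mul, mul_div_cancel_left₀ _ this]
    · have h1 : AnalyticAt ℂ (fun w => g w / (w - a) ^ n) w :=
        (hg w hw).div (by fun_prop) (pow_ne_zero _ (sub_ne_zero.2 hwa))
      refine h1.congr ?_
      filter_upwards [isOpen_ne.mem_nhds hwa] with x hx
      exact (hkw x hx).symm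
  · by_cases hwa : w = a
    · subst hwa; simp [h0, hn]
    · rw [hkw w hwa, mul_div_cancel₀]
      exact pow_ne_zero _ (sub_ne_zero.2 hwa)

/-- The weighted argument principle when the finite set `Z` of zeros is given, by induction on `Z`:
splitting off a zero `a` of order `n` adds `n / (w - a)` to the logarithmic derivative, and Cauchy's
formula evaluates the new term. -/
theorem exists_weights_circleIntegral_of_zeros {c : ℂ} {r : ℝ} (hr : 0 < r) (Z : Finset ℂ) :
    ∀ g : ℂ → ℂ, AnalyticOnNhd ℂ g (Metric.closedBall c r) →
      (∀ w ∈ Metric.sphere c r, g w ≠ 0) →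
      (∀ w, w ∈ Z ↔ w ∈ Metric.closedBall c r ∧ g w = 0) →
      ∃ μ : ℂ → ℕ, (∀ w ∈ Z, μ w ≠ 0) ∧ ∀ ψ : ℂ → ℂ,
        DifferentiableOn ℂ ψ (Metric.closedBall c r) →
        (∮ w in C(c, r), ψ w * (deriv g w / g w)) =
          2 * Real.pi * Complex.I * ∑ w ∈ Z, μ w * ψ w := by
  classical
  induction Z using Finset.induction_on with
  | empty =>
    intro g hg hs hZ
    refine ⟨0, by simp, fun ψ hψ => ?_⟩
    have hne : ∀ w ∈ Metric.closedBall c r, g w ≠ 0 := fun w hw h0 => by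
      simpa using (hZ w).2 ⟨hw, h0⟩
    have hd : DifferentiableOn ℂ (fun w => ψ w * (deriv g w / g w)) (Metric.closedBall c r) :=
      hψ.mul ((hg.deriv.differentiableOn).div hg.differentiableOn hne)
    rw [DiffContOnCl.circleIntegral_eq_zero hr.le
      (DifferentiableOn.diffContOnCl (by rwa [closure_ball _ hr.ne']))]
    simp
  | insert a Z haZ ih =>
    intro g hg hs hZ
    obtain ⟨haK, hga⟩ := (hZ a).1 (Finset.mem_insert_self a Z)
    have haB : a ∈ Metric.ball c r := by
      rw [← Metric.closedBall_sdiff_sphere]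
      exact ⟨haK, fun h => hs a h hga⟩
    have hne : ¬ ∀ᶠ w in 𝓝 a, g w = 0 := by
      intro hev
      have hz := hg.eqOn_zero_of_preconnected_of_eventuallyEq_zero
        (convex_closedBall c r).isPreconnected haK hev
      obtain ⟨w, hw⟩ := NormedSpace.sphere_nonempty (x := c) (r := r) |>.2 hr.le
      exact hs w hw (hz (Metric.sphere_subset_closedBall hw))
    obtain ⟨n, h, hn, hh, hha, hfac⟩ := exists_analyticOnNhd_pow_mul hg haK hga hne
    have hsh : ∀ w ∈ Metric.sphere c r, h w ≠ 0 := fun w hw h0 => hs w hw (by rw [hfac, h0, mul_zero])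
    obtain ⟨μ, hμ, hint⟩ := ih h hh hsh (by
      intro w
      constructor
      · intro hw
        obtain ⟨h1, h2⟩ := (hZ w).1 (Finset.mem_insert_of_mem hw)
        refine ⟨h1, ?_⟩
        rw [hfac] at h2
        rcases mul_eq_zero.1 h2 with h3 | h3
        · have : w = a := sub_eq_zero.1 (pow_eq_zero_iff hn |>.1 h3)
          exact absurd (this ▸ hw) haZ
        · exact h3
      · rintro ⟨h1, h2⟩
        have hw : w ∈ insert a Z := (hZ w).2 ⟨h1, by rw [hfac, h2, mul_zero]⟩
        rcases Finset.mem_insert.1 hw with rfl | h3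
        · exact absurd h2 hha
        · exact h3)
    refine ⟨Function.update μ a n, fun w hw => ?_, fun ψ hψ => ?_⟩
    · by_cases hwa : w = a
      · subst hwa; simpa using hn
      · rw [Function.update_of_ne hwa]
        exact hμ w ((Finset.mem_insert.1 hw).resolve_left hwa)
    have hsa : ∀ w ∈ Metric.sphere c r, w - a ≠ 0 := fun w hw h0 => by
      rw [sub_eq_zero.1 h0] at hw
      exact (Metric.mem_ball.1 haB).ne (Metric.mem_sphere.1 hw)
    have hlog : ∀ w ∈ Metric.sphere c r, ψ w * (deriv g w / g w) =
        n * ((w - a)⁻¹ • ψ w) + ψ w * (deriv h w / h w) := by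
      intro w hw
      have hd : deriv g w = n * (w - a) ^ (n - 1) * h w + (w - a) ^ n * deriv h w := by
        have h1 : HasDerivAt (fun w => (w - a) ^ n * h w)
            (n * (w - a) ^ (n - 1) * 1 * h w + (w - a) ^ n * deriv h w) w :=
          (((hasDerivAt_id w).sub_const a).pow n).mul
            (hh w (Metric.sphere_subset_closedBall hw)).differentiableAt.hasDerivAt
        rw [show g = fun w => (w - a) ^ n * h w from funext hfac, h1.deriv, mul_one]
      have hp : (w - a) ^ n = (w - a) ^ (n - 1) * (w - a) := by
        rw [← pow_succ, Nat.sub_add_cancel (Nat.one_le_iff_ne_zero.2 hn)]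
      have h1 := hsa w hw
      have h2 := hsh w hw
      rw [hd, hfac, hp, smul_eq_mul]
      field_simp
    have hcψ : ContinuousOn ψ (Metric.sphere c r) :=
      hψ.continuousOn.mono Metric.sphere_subset_closedBall
    have hch : ContinuousOn (fun w => ψ w * (deriv h w / h w)) (Metric.sphere c r) :=
      hcψ.mul ((hh.deriv.continuousOn.mono Metric.sphere_subset_closedBall).div
        (hh.continuousOn.mono Metric.sphere_subset_closedBall) hsh)
    have hca : ContinuousOn (fun w => (n : ℂ) * ((w - a)⁻¹ • ψ w)) (Metric.sphere c r) :=
      continuousOn_const.mul ((ContinuousOn.inv₀ (by fun_prop) hsa).smul hcψ)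
    rw [circleIntegral.integral_congr hr.le hlog,
      circleIntegral.integral_add (hca.circleIntegrable hr.le) (hch.circleIntegrable hr.le),
      hint ψ hψ, circleIntegral.integral_const_mul,
      DiffContOnCl.circleIntegral_sub_inv_smul
        (DifferentiableOn.diffContOnCl (by rwa [closure_ball _ hr.ne'])) haB,
      Finset.sum_insert haZ, Function.update_self]
    have : ∑ w ∈ Z, ((Function.update μ a n w : ℕ) : ℂ) * ψ w = ∑ w ∈ Z, (μ w : ℂ) * ψ w :=
      Finset.sum_congr rfl fun w hw => by
        rw [Function.update_of_ne]; rintro rfl; exact haZ hw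
    rw [this, smul_eq_mul]
    ring

/-- Argument principle with weights: `∮ ψ g' / g` is `2πi` times the sum of the values of `ψ` at
the zeros of `g` inside the circle, each counted with a positive multiplicity. -/
theorem exists_weights_circleIntegral {g : ℂ → ℂ} {c : ℂ} {r : ℝ} (hr : 0 < r)
    (hg : AnalyticOnNhd ℂ g (Metric.closedBall c r)) (hs : ∀ w ∈ Metric.sphere c r, g w ≠ 0) :
    ∃ (Z : Finset ℂ) (μ : ℂ → ℕ), (∀ w, w ∈ Z ↔ w ∈ Metric.ball c r ∧ g w = 0) ∧
      (∀ w ∈ Z, μ w ≠ 0) ∧ ∀ ψ : ℂ → ℂ, DifferentiableOn ℂ ψ (Metric.closedBall c r) →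
        (∮ w in C(c, r), ψ w * (deriv g w / g w)) =
          2 * Real.pi * Complex.I * ∑ w ∈ Z, μ w * ψ w := by
  have hfin := finite_zeros_closedBall hr hg hs
  obtain ⟨μ, hμ, h⟩ := exists_weights_circleIntegral_of_zeros hr hfin.toFinset g hg hs (by simp)
  refine ⟨hfin.toFinset, μ, fun w => ?_, hμ, h⟩
  rw [Set.Finite.mem_toFinset, ← Metric.closedBall_sdiff_sphere]
  exact ⟨fun h => ⟨⟨h.1, fun hw => hs w hw h.2⟩, h.2⟩, fun h => ⟨h.1.1, h.2⟩⟩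

/-! ### Counting zeros with Hankel determinants -/

/-- The Hankel matrix of the weighted power sums `∑ ν(w) w ^ k` is `Vᵀ diag(ν) V` with `V` a
Vandermonde matrix, so once its size bounds the number of nonzero weights, its determinant
detects whether that bound is attained. -/
theorem det_hankel_ne_zero_iff (Z : Finset ℂ) (ν : ℂ → ℂ) {m : ℕ}
    (hm : (Z.filter fun w => ν w ≠ 0).card ≤ m) :
    (Matrix.of fun i j : Fin m => ∑ w ∈ Z, ν w * w ^ (i + j : ℕ)).det ≠ 0 ↔
      (Z.filter fun w => ν w ≠ 0).card = m := by
  classical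
  -- pad the zeros of nonzero weight with points of weight zero
  obtain ⟨T, hT, hTc⟩ := Infinite.exists_superset_card_eq (Z.filter fun w => ν w ≠ 0) m hm
  let e : Fin m ≃ T := (T.equivFinOfCardEq hTc).symm
  let ν' : ℂ → ℂ := fun w => if w ∈ Z then ν w else 0
  have hsum : ∀ k : ℕ, ∑ w ∈ Z, ν w * w ^ k = ∑ l : Fin m, ν' (e l) * (e l : ℂ) ^ k := by
    intro k
    rw [Equiv.sum_comp e (fun t : T => ν' t * (t : ℂ) ^ k),
      Finset.sum_coe_sort T (fun t => ν' t * t ^ k),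
      ← Finset.sum_filter_of_ne (p := fun w => ν w ≠ 0)
        (fun x _ h => left_ne_zero_of_mul h)]
    refine Finset.sum_subset_zero_on_sdiff hT (fun x hx => ?_) (fun x hx => ?_)
    · rw [Finset.mem_sdiff, Finset.mem_filter] at hx
      by_cases h : x ∈ Z
      · have : ν x = 0 := by by_contra h0; exact hx.2 ⟨h, h0⟩
        simp [ν', this]
      · simp [ν', h]
    · simp [ν', (Finset.mem_filter.1 hx).1]
  have hmat : (Matrix.of fun i j : Fin m => ∑ w ∈ Z, ν w * w ^ (i + j : ℕ)) =
      (Matrix.vandermonde fun l => (e l : ℂ)).transpose * Matrix.diagonal (fun l => ν' (e l)) *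
        Matrix.vandermonde fun l => (e l : ℂ) := by
    ext i j
    rw [Matrix.mul_apply]
    simp only [Matrix.of_apply, hsum, Matrix.mul_diagonal, Matrix.transpose_apply,
      Matrix.vandermonde_apply]
    refine Finset.sum_congr rfl fun l _ => ?_
    ring
  have hV : (Matrix.vandermonde fun l => (e l : ℂ)).det ≠ 0 :=
    Matrix.det_vandermonde_ne_zero_iff.2 (Subtype.val_injective.comp e.injective)
  rw [hmat, Matrix.det_mul, Matrix.det_mul, Matrix.det_transpose, Matrix.det_diagonal]
  have : (Matrix.vandermonde fun l => (e l : ℂ)).det * (∏ l, ν' (e l)) *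
      (Matrix.vandermonde fun l => (e l : ℂ)).det ≠ 0 ↔ ∀ l, ν' (e l) ≠ 0 := by
    simp [hV, Finset.prod_eq_zero_iff]
  rw [this]
  constructor
  · intro h
    have hTs : T = Z.filter fun w => ν w ≠ 0 := by
      refine (Finset.Subset.antisymm hT fun t ht => ?_).symm
      have h1 := h (e.symm ⟨t, ht⟩)
      rw [Equiv.apply_symm_apply] at h1
      by_cases hz : t ∈ Z
      · simp only [ν', hz, if_true] at h1
        exact Finset.mem_filter.2 ⟨hz, h1⟩
      · simp [ν', hz] at h1
    rw [← hTs, hTc]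
  · intro h l
    have hTs : (Z.filter fun w => ν w ≠ 0) = T := Finset.eq_of_subset_of_card_le hT (by omega)
    have h1 : (e l : ℂ) ∈ Z.filter fun w => ν w ≠ 0 := hTs ▸ (e l).2
    have h2 := Finset.mem_filter.1 h1
    simpa [ν', h2.1] using h2.2

/-- The integral `(2πi)⁻¹ ∮ ψ(z, w) g_w(z, w) / g(z, w) dw` over a circle: the sum of `ψ(z, w)` over
the zeros `w` of `g(z, ·)` inside the circle, with multiplicity. -/
noncomputable def residueSum (g ψ : ℂ × ℂ → ℂ) (c : ℂ) (r : ℝ) (z : ℂ) : ℂ :=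
  (2 * Real.pi * Complex.I)⁻¹ *
    ∮ w in C(c, r), ψ (z, w) * (deriv (fun w => g (z, w)) w / g (z, w))

/-- If `g(a, ·)` has no zero on a circle, then for `z` near `a` the contour integral `residueSum` is
holomorphic in `z` and is a sum over the zeros of `g(z, ·)`, with multiplicities that do not depend
on `ψ`. -/
theorem exists_ball_residueSum {Ω : Set (ℂ × ℂ)} (hΩ : IsOpen Ω) {g : ℂ × ℂ → ℂ}
    (hg : DifferentiableOn ℂ g Ω) {a c : ℂ} {r : ℝ} (hr : 0 < r)
    (hsub : ∀ w ∈ Metric.closedBall c r, (a, w) ∈ Ω)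
    (hs : ∀ w ∈ Metric.sphere c r, g (a, w) ≠ 0) :
    ∃ ε > 0, (∀ z ∈ Metric.ball a ε, ∀ w ∈ Metric.closedBall c r, (z, w) ∈ Ω) ∧
      (∀ z ∈ Metric.ball a ε, ∀ w ∈ Metric.sphere c r, g (z, w) ≠ 0) ∧
      (∀ ψ : ℂ × ℂ → ℂ, DifferentiableOn ℂ ψ Ω →
        DifferentiableOn ℂ (residueSum g ψ c r) (Metric.ball a ε)) ∧
      ∀ z ∈ Metric.ball a ε, ∃ (Z : Finset ℂ) (μ : ℂ → ℕ),
        (∀ w, w ∈ Z ↔ w ∈ Metric.ball c r ∧ g (z, w) = 0) ∧ (∀ w ∈ Z, μ w ≠ 0) ∧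
        ∀ ψ : ℂ × ℂ → ℂ, DifferentiableOn ℂ ψ Ω →
          residueSum g ψ c r z = ∑ w ∈ Z, μ w * ψ (z, w) := by
  have h1 : ∀ᶠ z in 𝓝 a, ∀ w ∈ Metric.closedBall c r, (z, w) ∈ Ω :=
    (isCompact_closedBall c r).eventually_forall_of_forall_eventually fun w hw =>
      hΩ.mem_nhds (hsub w hw)
  have h2 : ∀ᶠ z in 𝓝 a, ∀ w ∈ Metric.sphere c r, g (z, w) ≠ 0 :=
    (isCompact_sphere c r).eventually_forall_of_forall_eventually fun w hw => by
      have := (hg.differentiableAt (hΩ.mem_nhds (hsub w (Metric.sphere_subset_closedBall hw)))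
        ).continuousAt
      exact this.eventually_ne (hs w hw)
  obtain ⟨ε, hε, hball⟩ := Metric.eventually_nhds_iff_ball.1 (h1.and h2)
  have hpi : (2 * Real.pi * Complex.I : ℂ) ≠ 0 := Complex.two_pi_I_ne_zero
  refine ⟨ε, hε, fun z hz => (hball z hz).1, fun z hz => (hball z hz).2, fun ψ hψ => ?_,
    fun z hz => ?_⟩
  · refine DifferentiableOn.const_mul (differentiableOn_circleIntegral_of_continuousOn
      (F := fun z w => ψ (z, w) * (deriv (fun w => g (z, w)) w / g (z, w)))
      Metric.isOpen_ball hr.le ?_ fun w hw => ?_) _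
    · have hmem : Metric.ball a ε ×ˢ Metric.sphere c r ⊆ Ω := fun x hx =>
        (hball x.1 hx.1).1 x.2 (Metric.sphere_subset_closedBall hx.2)
      exact (hψ.continuousOn.mono hmem).mul (((continuousOn_partialDeriv_snd hΩ hg).mono hmem).div
        (hg.continuousOn.mono hmem) fun x hx => (hball x.1 hx.1).2 x.2 hx.2)
    · intro z hz
      have hm := (hball z hz).1 w (Metric.sphere_subset_closedBall hw)
      exact ((differentiableAt_slice_fst hΩ hψ hm).mul
        ((differentiableAt_partialDeriv_fst hΩ hg hm).div
          (differentiableAt_slice_fst hΩ hg hm) ((hball z hz).2 w hw))).differentiableWithinAt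
  · obtain ⟨Z, μ, hZ, hμ, hint⟩ := exists_weights_circleIntegral (g := fun w => g (z, w)) hr
      (fun w hw => analyticAt_slice_snd hΩ hg ((hball z hz).1 w hw)) (hball z hz).2
    refine ⟨Z, μ, hZ, hμ, fun ψ hψ => ?_⟩
    have := hint (fun w => ψ (z, w)) fun w hw =>
      (differentiableAt_slice_snd hΩ hψ ((hball z hz).1 w hw)).differentiableWithinAt
    rw [residueSum, this, inv_mul_cancel_left₀ hpi]

/-- The number of zeros of `g(z, ·)` in a disc at which `ψ` does not vanish is constant for `z` in a
punctured neighbourhood: it attains its maximum where a holomorphic Hankel determinant does not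
vanish. -/
theorem exists_ncard_zeros_eventually_eq {Ω : Set (ℂ × ℂ)} (hΩ : IsOpen Ω) {g ψ : ℂ × ℂ → ℂ}
    (hg : DifferentiableOn ℂ g Ω) (hψ : DifferentiableOn ℂ ψ Ω) {a c : ℂ} {r : ℝ} (hr : 0 < r)
    (hsub : ∀ w ∈ Metric.closedBall c r, (a, w) ∈ Ω)
    (hs : ∀ w ∈ Metric.sphere c r, g (a, w) ≠ 0) :
    ∃ N : ℕ, ∀ᶠ z in 𝓝[≠] a,
      {w | w ∈ Metric.ball c r ∧ g (z, w) = 0 ∧ ψ (z, w) ≠ 0}.ncard = N := by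
  classical
  obtain ⟨ε, hε, -, -, hdiff, hsum⟩ := exists_ball_residueSum hΩ hg hr hsub hs
  let cnt : ℂ → ℕ := fun z => {w | w ∈ Metric.ball c r ∧ g (z, w) = 0 ∧ ψ (z, w) ≠ 0}.ncard
  have hcard : ∀ z, ∀ (Z : Finset ℂ) (μ : ℂ → ℕ),
      (∀ w, w ∈ Z ↔ w ∈ Metric.ball c r ∧ g (z, w) = 0) → (∀ w ∈ Z, μ w ≠ 0) →
      cnt z = (Z.filter fun w => (μ w : ℂ) * ψ (z, w) ≠ 0).card := by
    intro z Z μ hZ hμ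
    change Set.ncard {w | w ∈ Metric.ball c r ∧ g (z, w) = 0 ∧ ψ (z, w) ≠ 0} = _
    rw [← Set.ncard_coe_finset]
    congr 1
    ext w
    simp only [Finset.coe_filter, mem_ofPred_eq, hZ]
    constructor
    · rintro ⟨h1, h2, h3⟩
      exact ⟨⟨h1, h2⟩, mul_ne_zero (Nat.cast_ne_zero.2 (hμ w ((hZ w).2 ⟨h1, h2⟩))) h3⟩
    · rintro ⟨⟨h1, h2⟩, h3⟩
      exact ⟨h1, h2, right_ne_zero_of_mul h3⟩
  -- the total multiplicity is continuous, so the count is bounded near `a`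
  have h1d : DifferentiableOn ℂ (fun _ : ℂ × ℂ => (1 : ℂ)) Ω := differentiableOn_const _
  have hcont : ContinuousAt (residueSum g (fun _ => 1) c r) a :=
    ((hdiff _ h1d).differentiableAt (Metric.ball_mem_nhds a hε)).continuousAt
  obtain ⟨δ, hδ, hbd⟩ := Metric.eventually_nhds_iff_ball.1
    ((hcont.norm.eventually (gt_mem_nhds (lt_add_one _))).and (Metric.ball_mem_nhds a hε))
  obtain ⟨M, hM⟩ := exists_nat_gt (‖residueSum g (fun _ => 1) c r a‖ + 1)
  have hbound : ∀ z ∈ Metric.ball a δ, cnt z ≤ M := by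
    intro z hz
    obtain ⟨Z, μ, hZ, hμ, hres⟩ := hsum z (hbd z hz).2
    have h1 := hres _ h1d
    have h2 : (((∑ w ∈ Z, μ w : ℕ) : ℝ)) < M := by
      have h3 := (hbd z hz).1
      rw [h1] at h3
      simp only [mul_one] at h3
      rw [← Nat.cast_sum, Complex.norm_natCast] at h3
      exact h3.trans hM
    have h4 : Z.card ≤ ∑ w ∈ Z, μ w := by
      rw [Finset.card_eq_sum_ones]
      exact Finset.sum_le_sum fun w hw => Nat.one_le_iff_ne_zero.2 (hμ w hw)
    rw [hcard z Z μ hZ hμ]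
    have h5 := Finset.card_filter_le Z fun w => (μ w : ℂ) * ψ (z, w) ≠ 0
    have h6 : ∑ w ∈ Z, μ w < M := by exact_mod_cast h2
    omega
  let P : ℕ → Prop := fun n => ∃ z ∈ Metric.ball a δ, cnt z = n
  have hP : ∃ n, P n := ⟨_, a, Metric.mem_ball_self hδ, rfl⟩
  let m := Nat.findGreatest P M
  have hm : P m := by
    obtain ⟨n, z, hz, hn⟩ := hP
    exact Nat.findGreatest_spec (P := P) (hn ▸ hbound z hz) ⟨z, hz, hn⟩
  have hmax : ∀ z ∈ Metric.ball a δ, cnt z ≤ m := fun z hz =>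
    Nat.le_findGreatest (hbound z hz) ⟨z, hz, rfl⟩
  let H : ℂ → ℂ := fun z => (Matrix.of fun i j : Fin m =>
    residueSum g (fun x => ψ x * x.2 ^ (i + j : ℕ)) c r z).det
  have hball : Metric.ball a δ ⊆ Metric.ball a ε := fun z hz => (hbd z hz).2
  have hψk : ∀ k : ℕ, DifferentiableOn ℂ (fun x : ℂ × ℂ => ψ x * x.2 ^ k) Ω := fun k =>
    hψ.mul (by fun_prop)
  have hH : ∀ z ∈ Metric.ball a δ, H z ≠ 0 ↔ cnt z = m := by
    intro z hz
    obtain ⟨Z, μ, hZ, hμ, hres⟩ := hsum z (hball hz)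
    have h1 := hmax z hz
    rw [hcard z Z μ hZ hμ] at h1 ⊢
    rw [← det_hankel_ne_zero_iff Z (fun w => μ w * ψ (z, w)) h1]
    simp only [H, hres _ (hψk _), mul_assoc]
  have hHd : DifferentiableOn ℂ H (Metric.ball a δ) := by
    simp only [H, Matrix.det_apply]
    refine DifferentiableOn.fun_sum fun σ _ => ?_
    refine DifferentiableOn.const_smul ?_ _
    refine DifferentiableOn.fun_finsetProd fun i _ => ?_
    exact (hdiff _ (hψk _)).mono hball
  have hHa : AnalyticOnNhd ℂ H (Metric.ball a δ) := hHd.analyticOnNhd Metric.isOpen_ball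
  refine ⟨m, ?_⟩
  rcases (hHa a (Metric.mem_ball_self hδ)).eventually_eq_zero_or_eventually_ne_zero with h | h
  · obtain ⟨z, hz, hzm⟩ := hm
    exact absurd (hHa.eqOn_zero_of_preconnected_of_eventuallyEq_zero
      (convex_ball a δ).isPreconnected (Metric.mem_ball_self hδ) h hz) ((hH z hz).2 hzm)
  · filter_upwards [h, nhdsWithin_le_nhds (Metric.ball_mem_nhds a hδ)] with z hz hzb
    exact (hH z hzb).1 hz

/-- If the number of zeros of `g(z, ·)` in a disc is constant near `z₀`, then the zeros are
holomorphic functions of `z` near `z₀`: each stays alone in its own small disc. -/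
theorem exists_branches_of_ncard_zeros_eq {Ω : Set (ℂ × ℂ)} (hΩ : IsOpen Ω) {g : ℂ × ℂ → ℂ}
    (hg : DifferentiableOn ℂ g Ω) {z₀ c : ℂ} {r : ℝ} (hr : 0 < r)
    (hsub : ∀ w ∈ Metric.closedBall c r, (z₀, w) ∈ Ω)
    (hs : ∀ w ∈ Metric.sphere c r, g (z₀, w) ≠ 0) {N : ℕ}
    (hN : ∀ᶠ z in 𝓝 z₀, {w | w ∈ Metric.ball c r ∧ g (z, w) = 0}.ncard = N) :
    ∃ (Z : Finset ℂ) (f : Z → ℂ → ℂ), (∀ i, AnalyticAt ℂ (f i) z₀) ∧ (∀ i, f i z₀ = i) ∧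
      ∀ᶠ z in 𝓝 z₀, (Function.Injective fun i => f i z) ∧
        {w | w ∈ Metric.ball c r ∧ g (z, w) = 0} = range fun i => f i z := by
  classical
  obtain ⟨ε₀, hε₀, -, -, -, hsum₀⟩ := exists_ball_residueSum hΩ hg hr hsub hs
  obtain ⟨Z, -, hZ, -, -⟩ := hsum₀ z₀ (Metric.mem_ball_self hε₀)
  -- a common radius for disjoint discs around the zeros
  have hρ : ∀ᶠ ρ in 𝓝[>] (0 : ℝ), 0 < ρ ∧ ∀ w ∈ Z, Metric.closedBall w ρ ⊆ Metric.ball c r ∧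
      ∀ w' ∈ Z, w' ≠ w → 2 * ρ < dist w' w := by
    refine eventually_mem_nhdsWithin.and ((Finset.eventually_all Z).2 fun w hw => ?_)
    refine Eventually.and ?_ ((Finset.eventually_all Z).2 fun w' _ => ?_)
    · exact eventually_nhdsWithin_of_eventually_nhds
        (eventually_closedBall_subset (Metric.isOpen_ball.mem_nhds ((hZ w).1 hw).1))
    · by_cases h : w' = w
      · simp [h]
      · have : ContinuousAt (fun ρ : ℝ => 2 * ρ) 0 := by fun_prop
        filter_upwards [nhdsWithin_le_nhds (this.eventually_lt continuousAt_const
          (by simpa using h : 2 * (0 : ℝ) < dist w' w))] with ρ hρ _ using hρ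
  obtain ⟨ρ, hρ0, hρ⟩ := hρ.exists
  have hcb : ∀ w ∈ Z, ∀ x ∈ Metric.closedBall w ρ, g (z₀, x) = 0 → x = w := by
    intro w hw x hx h0
    by_contra hne
    have h1 := (hρ w hw).2 x ((hZ x).2 ⟨(hρ w hw).1 hx, h0⟩) hne
    have h2 := Metric.mem_closedBall.1 hx
    linarith
  have hloc : ∀ w : Z, ∃ ε > 0,
      (∀ ψ : ℂ × ℂ → ℂ, DifferentiableOn ℂ ψ Ω →
        DifferentiableOn ℂ (residueSum g ψ w ρ) (Metric.ball z₀ ε)) ∧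
      ∀ z ∈ Metric.ball z₀ ε, ∃ (Z : Finset ℂ) (μ : ℂ → ℕ),
        (∀ x, x ∈ Z ↔ x ∈ Metric.ball (w : ℂ) ρ ∧ g (z, x) = 0) ∧ (∀ x ∈ Z, μ x ≠ 0) ∧
        ∀ ψ : ℂ × ℂ → ℂ, DifferentiableOn ℂ ψ Ω →
          residueSum g ψ w ρ z = ∑ x ∈ Z, μ x * ψ (z, x) := by
    intro w
    obtain ⟨ε, hε, -, -, h1, h2⟩ := exists_ball_residueSum hΩ hg hρ0 (a := z₀) (c := w)
      (fun x hx => hsub x (Metric.ball_subset_closedBall ((hρ w w.2).1 hx)))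
      (fun x hx h0 => by
        have := hcb w w.2 x (Metric.sphere_subset_closedBall hx) h0
        rw [this, Metric.mem_sphere, dist_self] at hx
        exact hρ0.ne hx)
    exact ⟨ε, hε, h1, h2⟩
  choose ε hε hdiff hres using hloc
  have h1d : DifferentiableOn ℂ (fun _ : ℂ × ℂ => (1 : ℂ)) Ω := differentiableOn_const _
  have h2d : DifferentiableOn ℂ (fun x : ℂ × ℂ => x.2) Ω := by fun_prop
  have hne : ∀ w : Z, residueSum g (fun _ => 1) w ρ z₀ ≠ 0 := by
    intro w
    obtain ⟨Y, μ, hY, hμ, hr⟩ := hres w z₀ (Metric.mem_ball_self (hε w))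
    have hYw : Y = {(w : ℂ)} := by
      ext x
      rw [hY, Finset.mem_singleton]
      constructor
      · rintro ⟨h1, h2⟩
        exact hcb w w.2 x (Metric.ball_subset_closedBall h1) h2
      · rintro rfl
        exact ⟨Metric.mem_ball_self hρ0, ((hZ _).1 w.2).2⟩
    rw [hr _ h1d, hYw]
    simpa using hμ w (by simp [hYw])
  have han : ∀ ψ : ℂ × ℂ → ℂ, DifferentiableOn ℂ ψ Ω → ∀ w : Z,
      AnalyticAt ℂ (residueSum g ψ w ρ) z₀ := fun ψ hψ w =>
    (hdiff w ψ hψ).analyticAt (Metric.ball_mem_nhds _ (hε w))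
  have hmain : ∀ᶠ z in 𝓝 z₀, (∀ w : Z, residueSum g (fun x => x.2) w ρ z /
        residueSum g (fun _ => 1) w ρ z ∈ Metric.ball (w : ℂ) ρ) ∧
      {w | w ∈ Metric.ball c r ∧ g (z, w) = 0} =
        range fun w : Z => residueSum g (fun x => x.2) w ρ z / residueSum g (fun _ => 1) w ρ z := by
    have hcardZ : Z.card = N := by
      rw [← hN.self_of_nhds, ← Set.ncard_coe_finset]
      congr 1
      ext w
      simp [hZ]
    have e1 : ∀ᶠ z in 𝓝 z₀, ∀ w : Z, residueSum g (fun _ => 1) w ρ z ≠ 0 ∧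
        z ∈ Metric.ball z₀ (ε w) := eventually_all.2 fun w =>
      ((han _ h1d w).continuousAt.eventually_ne (hne w)).and (Metric.ball_mem_nhds _ (hε w))
    filter_upwards [e1, hN, Metric.ball_mem_nhds z₀ hε₀] with z hz hzN hzε
    obtain ⟨S, -, hS, -, -⟩ := hsum₀ z hzε
    have hSeq : {w | w ∈ Metric.ball c r ∧ g (z, w) = 0} = (S : Set ℂ) := by
      ext w; simp [hS]
    have hex : ∀ w : Z, ∃ x, x ∈ Metric.ball (w : ℂ) ρ ∧ g (z, x) = 0 := by
      intro w
      obtain ⟨Y, μ, hY, hμ, hr⟩ := hres w z (hz w).2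
      by_contra hcon
      push Not at hcon
      have hYe : Y = ∅ := Finset.eq_empty_of_forall_notMem fun x hx =>
        hcon x ((hY x).1 hx).1 ((hY x).1 hx).2
      apply (hz w).1
      rw [hr _ h1d, hYe]
      simp
    choose h hhb hh0 using hex
    have hdisj : ∀ w w' : Z, ∀ x, x ∈ Metric.ball (w : ℂ) ρ → x ∈ Metric.ball (w' : ℂ) ρ →
        w = w' := by
      intro w w' x hx hx'
      by_contra hne
      have h1 := (hρ w' w'.2).2 w w.2 (fun h => hne (Subtype.ext h))
      rw [Metric.mem_ball] at hx hx'
      have h2 := dist_triangle_left (w : ℂ) w' x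
      linarith
    have hinj : Function.Injective h := fun w w' hww =>
      hdisj w w' (h w) (hhb w) (hww ▸ hhb w')
    have hrange : range h = (S : Set ℂ) := by
      refine Set.eq_of_subset_of_ncard_le ?_ ?_ S.finite_toSet
      · rintro _ ⟨w, rfl⟩
        exact (hS _).2 ⟨(hρ w w.2).1 (Metric.ball_subset_closedBall (hhb w)), hh0 w⟩
      · rw [← hSeq, hzN, ← hcardZ, ← image_univ, Set.ncard_image_of_injective _ hinj,
          Set.ncard_univ, Nat.card_eq_fintype_card, Fintype.card_coe]
    have hval : ∀ w : Z, residueSum g (fun x => x.2) w ρ z /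
        residueSum g (fun _ => 1) w ρ z = h w := by
      intro w
      obtain ⟨Y, μ, hY, hμ, hr⟩ := hres w z (hz w).2
      have hYw : Y = {h w} := by
        ext x
        rw [hY, Finset.mem_singleton]
        constructor
        · rintro ⟨h1, h2⟩
          have : x ∈ range h := by
            rw [hrange]
            exact (hS x).2 ⟨(hρ w w.2).1 (Metric.ball_subset_closedBall h1), h2⟩
          obtain ⟨w', rfl⟩ := this
          rw [hdisj w w' _ h1 (hhb w')]
        · rintro rfl
          exact ⟨hhb w, hh0 w⟩
      have hμ' : (μ (h w) : ℂ) ≠ 0 := Nat.cast_ne_zero.2 (hμ _ (by simp [hYw]))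
      rw [hr _ h1d, hr _ h2d, hYw]
      simp only [Finset.sum_singleton, mul_one]
      exact mul_div_cancel_left₀ _ hμ'
    refine ⟨fun w => (hval w).symm ▸ hhb w, ?_⟩
    simp only [hval]
    rw [hSeq, hrange]
  refine ⟨Z, fun w z => residueSum g (fun x => x.2) w ρ z / residueSum g (fun _ => 1) w ρ z,
    fun w => (han _ h2d w).div (han _ h1d w) (hne w), fun w => ?_, ?_⟩
  · have h := hmain.self_of_nhds
    have h1 := h.2.superset (mem_range_self w)
    exact hcb w w.2 _ (Metric.ball_subset_closedBall (h.1 w)) h1.2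
  · filter_upwards [hmain] with z hz
    refine ⟨fun w w' hww => ?_, hz.2⟩
    by_contra hne
    have h1 := (hρ w' w'.2).2 w w.2 (fun h => hne (Subtype.ext h))
    have hx := hz.1 w
    have hx' := hz.1 w'
    simp only at hww
    rw [hww] at hx
    rw [Metric.mem_ball] at hx hx'
    have h2 := dist_triangle_left (w : ℂ) w' (residueSum g (fun x => x.2) w' ρ z /
      residueSum g (fun _ => 1) w' ρ z)
    linarith

/-- The common zeros in a disc of finitely many holomorphic functions of two variables are locally,
over a punctured neighbourhood, given by holomorphic functions with disjoint graphs. -/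
theorem eventually_exists_branches_commonZeros {Ω : Set (ℂ × ℂ)} (hΩ : IsOpen Ω) {n : ℕ}
    {g : Fin n → ℂ × ℂ → ℂ} (hg : ∀ k, DifferentiableOn ℂ (g k) Ω) {a c : ℂ} {r : ℝ}
    (hr : 0 < r) (hsub : ∀ w ∈ Metric.closedBall c r, (a, w) ∈ Ω) {k₀ : Fin n}
    (hs : ∀ w ∈ Metric.sphere c r, g k₀ (a, w) ≠ 0) :
    ∀ᶠ z₀ in 𝓝[≠] a, ∃ (I : Finset ℂ) (f : I → ℂ → ℂ), (∀ i, AnalyticAt ℂ (f i) z₀) ∧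
      (Function.Injective fun i => f i z₀) ∧
      ∀ᶠ z in 𝓝 z₀, {w | w ∈ Metric.ball c r ∧ ∀ k, g k (z, w) = 0} = range fun i => f i z := by
  classical
  obtain ⟨N, hN⟩ := exists_ncard_zeros_eventually_eq hΩ (hg k₀)
    (differentiableOn_const (c := (1 : ℂ))) hr hsub hs
  have hNk : ∀ k, ∃ N : ℕ, ∀ᶠ z in 𝓝[≠] a,
      {w | w ∈ Metric.ball c r ∧ g k₀ (z, w) = 0 ∧ g k (z, w) ≠ 0}.ncard = N := fun k =>
    exists_ncard_zeros_eventually_eq hΩ (hg k₀) (hg k) hr hsub hs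
  choose Nk hNk using hNk
  obtain ⟨ε, hε, hb1, hb2, -, -⟩ := exists_ball_residueSum hΩ (hg k₀) hr hsub hs
  have hall := (hN.and ((eventually_all.2 hNk).and
    (nhdsWithin_le_nhds (Metric.ball_mem_nhds a hε))))
  filter_upwards [eventually_eventually_nhdsWithin.2 hall, self_mem_nhdsWithin] with z₀ h0 hne
  rw [nhdsWithin_eq_nhds.2 (isOpen_compl_singleton.mem_nhds hne)] at h0
  have hz₀ := h0.self_of_nhds.2.2
  obtain ⟨Z, f, hfa, hfz, hf⟩ := exists_branches_of_ncard_zeros_eq hΩ (hg k₀) hr (hb1 z₀ hz₀)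
    (hb2 z₀ hz₀) (N := N) (by
      filter_upwards [h0] with z hz
      simpa using hz.1)
  let I : Finset ℂ := Z.filter fun w => ∀ k, g k (z₀, w) = 0
  have hIZ : I ⊆ Z := Finset.filter_subset _ _
  have hZsub : ∀ i : Z, (i : ℂ) ∈ Metric.ball c r := by
    intro i
    have := hf.self_of_nhds.2.superset (mem_range_self i)
    rw [hfz] at this
    exact this.1
  refine ⟨I, fun i => f ⟨i, hIZ i.2⟩, fun i => hfa _, fun i j hij => ?_, ?_⟩
  · have : f ⟨i, hIZ i.2⟩ z₀ = f ⟨j, hIZ j.2⟩ z₀ := hij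
    rw [hfz, hfz] at this
    exact Subtype.ext this
  -- for each `k`, as many zeros with `g k ≠ 0` near `z₀` as at `z₀`, and these persist
  have hk : ∀ k, ∀ᶠ z in 𝓝 z₀, ∀ i : Z, g k (z, f i z) = 0 ↔ g k (z₀, i) = 0 := by
    intro k
    have hper : ∀ᶠ z in 𝓝 z₀, ∀ i : Z, g k (z₀, i) ≠ 0 → g k (z, f i z) ≠ 0 := by
      refine eventually_all.2 fun i => ?_
      by_cases hi : g k (z₀, i) = 0
      · simp [hi]
      · have hm : (z₀, (i : ℂ)) ∈ Ω :=
          hb1 z₀ hz₀ i (Metric.ball_subset_closedBall (hZsub i))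
        have hc1 : ContinuousAt (g k) (z₀, f i z₀) := by
          rw [hfz]
          exact ((hg k).differentiableAt (hΩ.mem_nhds hm)).continuousAt
        have hc2 : ContinuousAt (fun z => (z, f i z)) z₀ :=
          continuousAt_id.prodMk (hfa i).continuousAt
        have hc : ContinuousAt (fun z => g k (z, f i z)) z₀ :=
          ContinuousAt.comp (f := fun z => (z, f i z)) hc1 hc2
        filter_upwards [hc.eventually_ne (y := 0) (by rwa [hfz])] with z hz _ using hz
    have hset : ∀ z, (Function.Injective fun i => f i z) →
        {w | w ∈ Metric.ball c r ∧ g k₀ (z, w) = 0} = (range fun i => f i z) →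
        {w | w ∈ Metric.ball c r ∧ g k₀ (z, w) = 0 ∧ g k (z, w) ≠ 0}.ncard =
          (Finset.univ.filter fun i : Z => g k (z, f i z) ≠ 0).card := by
      intro z hinj hr
      rw [← Set.ncard_coe_finset, ← Set.ncard_image_of_injective _ hinj]
      congr 1
      ext w
      simp only [Finset.coe_filter, Finset.mem_univ, true_and, mem_image, mem_ofPred_eq]
      constructor
      · rintro ⟨h1, h2, h3⟩
        obtain ⟨i, rfl⟩ := hr.subset ⟨h1, h2⟩
        exact ⟨i, h3, rfl⟩
      · rintro ⟨i, h3, rfl⟩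
        have := hr.superset (mem_range_self i)
        exact ⟨this.1, this.2, h3⟩
    have hc0 := hset z₀ hf.self_of_nhds.1 hf.self_of_nhds.2
    rw [h0.self_of_nhds.2.1 k] at hc0
    simp only [hfz] at hc0
    filter_upwards [hper, h0, hf] with z hz1 hz2 hz3 i
    have hcz := hset z hz3.1 hz3.2
    rw [hz2.2.1 k, hc0] at hcz
    have := Finset.eq_of_subset_of_card_le
      (s := Finset.univ.filter fun i : Z => g k (z₀, i) ≠ 0)
      (t := Finset.univ.filter fun i : Z => g k (z, f i z) ≠ 0)
      (fun i hi => by simpa using hz1 i (by simpa using hi)) hcz.ge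
    have h4 := Finset.ext_iff.1 this i
    simp only [Finset.mem_filter, Finset.mem_univ, true_and] at h4
    exact (not_iff_not.1 h4).symm
  filter_upwards [eventually_all.2 hk, hf] with z hz1 hz2
  ext w
  constructor
  · rintro ⟨h1, h2⟩
    obtain ⟨i, rfl⟩ := hz2.2.subset ⟨h1, h2 k₀⟩
    exact ⟨⟨i, Finset.mem_filter.2 ⟨i.2, fun k => (hz1 k i).1 (h2 k)⟩⟩, rfl⟩
  · rintro ⟨i, rfl⟩
    have := hz2.2.superset (mem_range_self (⟨i, hIZ i.2⟩ : Z))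
    exact ⟨this.1, fun k => (hz1 k _).2 ((Finset.mem_filter.1 i.2).2 k)⟩

/-! ### Fibres of a proper correspondence -/

theorem IsProperHolomorphicCorrespondence.swap {D₁ D₂ : Set ℂ} {V : Set (ℂ × ℂ)}
    (hV : IsProperHolomorphicCorrespondence D₁ D₂ V) :
    IsProperHolomorphicCorrespondence D₂ D₁ (Prod.swap ⁻¹' V) := by
  obtain ⟨⟨hsub, hloc⟩, h1, h2⟩ := hV
  have hpre : ∀ K : Set (ℂ × ℂ), IsCompact K → IsCompact (Prod.swap ⁻¹' K) := fun K hK =>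
    (Homeomorph.prodComm ℂ ℂ).isClosedEmbedding.isCompact_preimage hK
  refine ⟨⟨fun x hx => ⟨(hsub hx).2, (hsub hx).1⟩, fun x hx => ?_⟩, fun K hK hc => ?_,
    fun K hK hc => ?_⟩
  · obtain ⟨U, hU, hxU, hUsub, n, g, hg, hVU⟩ := hloc x.swap ⟨hx.2, hx.1⟩
    refine ⟨Prod.swap ⁻¹' U, hU.preimage continuous_swap, hxU,
      fun y hy => ⟨(hUsub hy).2, (hUsub hy).1⟩, n, fun i y => g i y.swap, fun i => ?_, ?_⟩
    · exact (hg i).comp (f := Prod.swap) (by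
        have : Differentiable ℂ (fun x : ℂ × ℂ => (x.2, x.1)) := by fun_prop
        exact this.differentiableOn) (fun y hy => hy)
    · rw [← preimage_inter, hVU]
      rfl
  · exact hpre _ (h2 K hK hc)
  · exact hpre _ (h1 K hK hc)

section Fibres

variable {D₁ D₂ : Set ℂ} {V : Set (ℂ × ℂ)}

theorem IsProperHolomorphicCorrespondence.isCompact_corrMap
    (hV : IsProperHolomorphicCorrespondence D₁ D₂ V) {a : ℂ} (ha : a ∈ D₁) :
    IsCompact (corrMap V a) := by
  have h := (hV.2.1 {a} (by simpa using ha) isCompact_singleton).image continuous_snd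
  convert h using 1
  ext w
  simp only [corrMap, mem_ofPred_eq, mem_image, mem_inter_iff, mem_preimage, mem_singleton_iff]
  constructor
  · intro hw; exact ⟨(a, w), ⟨hw, rfl⟩, rfl⟩
  · rintro ⟨⟨z, w'⟩, ⟨h1, h2⟩, h3⟩
    dsimp only at h2 h3
    subst h2; subst h3; exact h1

theorem IsProperHolomorphicCorrespondence.corrMap_subset
    (hV : IsProperHolomorphicCorrespondence D₁ D₂ V) (a : ℂ) : corrMap V a ⊆ D₂ :=
  fun _ hw => (hV.1.1 hw).2

/-- The fibres of a proper correspondence are finite: the set of interior points of a fibre is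
closed in `D₂` by the identity theorem, and a fibre is compact, so it is not all of `D₂`. -/
theorem IsProperHolomorphicCorrespondence.finite_corrMap (hD₂ : IsPlanarDomain D₂)
    (hV : IsProperHolomorphicCorrespondence D₁ D₂ V) {a : ℂ} (ha : a ∈ D₁) :
    (corrMap V a).Finite := by
  by_contra hinf
  have hcomp := hV.isCompact_corrMap ha
  have hint : ∀ w ∈ D₂, AccPt w (𝓟 (corrMap V a)) → w ∈ interior (corrMap V a) := by
    intro w hw hacc
    obtain ⟨U, hU, hxU, hUsub, n, g, hg, hVU⟩ := hV.1.2 (a, w) ⟨ha, hw⟩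
    have hUw : ∀ᶠ w' in 𝓝 w, (a, w') ∈ U := (isOpen_slice_snd hU a).mem_nhds hxU
    have hfreq := accPt_iff_frequently_nhdsNE.1 hacc
    have hz : ∀ i, ∀ᶠ w' in 𝓝 w, g i (a, w') = 0 := by
      intro i
      rcases (analyticAt_slice_snd hU (hg i) hxU).eventually_eq_zero_or_eventually_ne_zero
        with h | h
      · exact h
      · exfalso
        apply hfreq
        filter_upwards [h, nhdsWithin_le_nhds hUw] with w' h1 h2 h3
        have : (a, w') ∈ V ∩ U := ⟨h3, h2⟩
        rw [hVU] at this
        exact h1 (this.2 i)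
    rw [mem_interior_iff_mem_nhds]
    filter_upwards [eventually_all.2 hz, hUw] with w' h1 h2
    have : (a, w') ∈ V ∩ U := by rw [hVU]; exact ⟨h2, h1⟩
    exact this.1
  obtain ⟨w, hw, hacc⟩ := Set.Infinite.exists_accPt_of_subset_isCompact hinf hcomp Subset.rfl
  have hwD := hV.corrMap_subset a hw
  have hsub : D₂ ⊆ interior (corrMap V a) := by
    refine hD₂.2.isPreconnected.subset_of_closure_inter_subset isOpen_interior
      ⟨w, hwD, hint w hwD hacc⟩ ?_
    rintro x ⟨hx, hxD⟩
    by_cases hxi : x ∈ interior (corrMap V a)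
    · exact hxi
    · refine hint x hxD ?_
      rw [accPt_iff_frequently_nhdsNE, frequently_nhdsWithin_iff]
      refine (mem_closure_iff_frequently.1 hx).mono fun y hy => ⟨interior_subset hy, ?_⟩
      rintro rfl
      exact hxi hy
  have heq : D₂ = corrMap V a :=
    (hsub.trans interior_subset).antisymm (hV.corrMap_subset a)
  have hcl : IsClopen D₂ := ⟨heq ▸ hcomp.isClosed, hD₂.1⟩
  have huniv := hcl.eq_univ hD₂.2.nonempty
  exact noncompact_univ ℂ (huniv ▸ heq ▸ hcomp)

/-- Properness: fibres over nearby points stay close to the given fibre. -/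
theorem IsProperHolomorphicCorrespondence.eventually_corrMap_subset (hD₁ : IsOpen D₁)
    (hV : IsProperHolomorphicCorrespondence D₁ D₂ V) {a : ℂ} (ha : a ∈ D₁) {U : Set ℂ}
    (hU : IsOpen U) (haU : corrMap V a ⊆ U) : ∀ᶠ z in 𝓝 a, corrMap V z ⊆ U := by
  obtain ⟨ε, hε, hεD⟩ := Metric.nhds_basis_closedBall.mem_iff.1 (hD₁.mem_nhds ha)
  have hC : IsCompact (V ∩ Prod.fst ⁻¹' Metric.closedBall a ε ∩ Prod.snd ⁻¹' Uᶜ) :=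
    (hV.2.1 _ hεD (isCompact_closedBall a ε)).inter_right
      (hU.isClosed_compl.preimage continuous_snd)
  have hcl := (hC.image continuous_fst).isClosed
  have hna : a ∉ Prod.fst '' (V ∩ Prod.fst ⁻¹' Metric.closedBall a ε ∩ Prod.snd ⁻¹' Uᶜ) := by
    rintro ⟨⟨z, w⟩, ⟨⟨h1, -⟩, h2⟩, h3⟩
    dsimp only at h3
    subst h3
    exact h2 (haU h1)
  filter_upwards [hcl.isOpen_compl.mem_nhds hna, Metric.closedBall_mem_nhds a hε] with z hz hzε w hw
  by_contra hwU
  exact hz ⟨(z, w), ⟨⟨hw, hzε⟩, hwU⟩, rfl⟩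

/-! ### Existence of branches -/

/-- Near `z₀`, the multivalued function `Φ` is given by finitely many holomorphic functions whose
graphs are disjoint. -/
def HasDisjointBranches (Φ : ℂ → Set ℂ) (z₀ : ℂ) : Prop :=
  ∃ (n : ℕ) (f : Fin n → ℂ → ℂ), (∀ i, AnalyticAt ℂ (f i) z₀) ∧
    (Function.Injective fun i => f i z₀) ∧ ∀ᶠ z in 𝓝 z₀, Φ z = range fun i => f i z

theorem HasDisjointBranches.of_finite {Φ : ℂ → Set ℂ} {z₀ : ℂ} {ι : Type} [Finite ι]
    (f : ι → ℂ → ℂ) (hf : ∀ i, AnalyticAt ℂ (f i) z₀)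
    (hinj : Function.Injective fun i => f i z₀) (h : ∀ᶠ z in 𝓝 z₀, Φ z = range fun i => f i z) :
    HasDisjointBranches Φ z₀ := by
  obtain ⟨n, ⟨e⟩⟩ := Finite.exists_equiv_fin ι
  refine ⟨n, fun i => f (e.symm i), fun i => hf _, hinj.comp e.symm.injective, ?_⟩
  filter_upwards [h] with z hz
  rw [hz]
  exact (e.symm.surjective.range_comp fun i => f i z).symm

theorem eventually_injective_of_continuousAt {ι : Type*} [Finite ι] {f : ι → ℂ → ℂ} {z₀ : ℂ}
    (hf : ∀ i, ContinuousAt (f i) z₀) (hinj : Function.Injective fun i => f i z₀) :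
    ∀ᶠ z in 𝓝 z₀, Function.Injective fun i => f i z := by
  have : ∀ᶠ z in 𝓝 z₀, ∀ i j, i ≠ j → f i z ≠ f j z := by
    refine eventually_all.2 fun i => eventually_all.2 fun j => ?_
    by_cases hij : i = j
    · simp [hij]
    · have h0 := ((hf i).sub (hf j)).eventually_ne (y := 0)
        (sub_ne_zero.2 fun h => hij (hinj h))
      filter_upwards [h0] with z hz _ using sub_ne_zero.1 hz
  filter_upwards [this] with z hz i j hij
  by_contra hne
  exact hz i j hne hij

theorem IsLocalBranches.of_injective {Φ : ℂ → Set ℂ} {z₀ : ℂ} {n : ℕ} {f : Fin n → ℂ → ℂ}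
    (hf : ∀ i, AnalyticAt ℂ (f i) z₀) (hinj : Function.Injective fun i => f i z₀)
    (h : ∀ᶠ z in 𝓝 z₀, Φ z = range fun i => f i z) : IsLocalBranches Φ z₀ f :=
  ⟨hf, h, fun _ _ hij he => hij (hinj he.self_of_nhds)⟩

/-- Near `a`, properness confines the fibres to small disjoint discs around the points of the fibre
over `a`. In each disc `V` is a set of common zeros, which has disjoint branches over a punctured
neighbourhood of `a`. -/
theorem IsProperHolomorphicCorrespondence.eventually_hasDisjointBranches (hD₁ : IsOpen D₁)
    (hD₂ : IsPlanarDomain D₂) (hV : IsProperHolomorphicCorrespondence D₁ D₂ V) {a : ℂ}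
    (ha : a ∈ D₁) : ∀ᶠ z in 𝓝[≠] a, HasDisjointBranches (corrMap V) z := by
  classical
  have hfin := hV.finite_corrMap hD₂ ha
  let F : Finset ℂ := hfin.toFinset
  have hF : ∀ b : F, (b : ℂ) ∈ corrMap V a := fun b => hfin.mem_toFinset.1 b.2
  have hdata : ∀ b : F, ∃ U : Set (ℂ × ℂ), IsOpen U ∧ (a, (b : ℂ)) ∈ U ∧
      ∃ (n : ℕ) (g : Fin n → ℂ × ℂ → ℂ) (k : Fin n), (∀ i, DifferentiableOn ℂ (g i) U) ∧
        V ∩ U = {y ∈ U | ∀ i, g i y = 0} ∧ ∀ᶠ w in 𝓝[≠] (b : ℂ), g k (a, w) ≠ 0 := by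
    intro b
    obtain ⟨U, hU, hxU, hUsub, n, g, hg, hVU⟩ := hV.1.2 (a, b) (hV.1.1 (hF b))
    refine ⟨U, hU, hxU, n, g, ?_⟩
    by_contra hcon
    push Not at hcon
    have hz : ∀ i, ∀ᶠ w in 𝓝 (b : ℂ), g i (a, w) = 0 := by
      intro i
      rcases (analyticAt_slice_snd hU (hg i) hxU).eventually_eq_zero_or_eventually_ne_zero
        with h | h
      · exact h
      · exact absurd h (by simpa using hcon i hg hVU)
    have hnhds : corrMap V a ∈ 𝓝 (b : ℂ) := by
      filter_upwards [eventually_all.2 hz, (isOpen_slice_snd hU a).mem_nhds hxU] with w h1 h2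
      have : (a, w) ∈ V ∩ U := by rw [hVU]; exact ⟨h2, h1⟩
      exact this.1
    exact infinite_of_mem_nhds (b : ℂ) hnhds hfin
  choose U hU hbU n g k hg hVU hk using hdata
  have hρ : ∀ᶠ ρ in 𝓝[>] (0 : ℝ), 0 < ρ ∧ ∀ b : F,
      Metric.closedBall (b : ℂ) ρ ⊆ {w | (a, w) ∈ U b ∧ (w ≠ b → g b (k b) (a, w) ≠ 0)} ∧
      ∀ b' : F, b' ≠ b → 2 * ρ < dist (b' : ℂ) b := by
    refine eventually_mem_nhdsWithin.and (eventually_all.2 fun b => ?_)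
    refine Eventually.and ?_ (eventually_all.2 fun b' => ?_)
    · refine eventually_nhdsWithin_of_eventually_nhds (eventually_closedBall_subset ?_)
      exact inter_mem ((isOpen_slice_snd (hU b) a).mem_nhds (hbU b))
        (eventually_nhdsWithin_iff.1 (hk b))
    · by_cases h : b' = b
      · simp [h]
      · have : ContinuousAt (fun ρ : ℝ => 2 * ρ) 0 := by fun_prop
        filter_upwards [nhdsWithin_le_nhds (this.eventually_lt continuousAt_const
          (by
            rw [mul_zero]; exact dist_pos.2 fun he => h (Subtype.ext he) :
            2 * (0 : ℝ) < dist (b' : ℂ) b))] with ρ hρ _ using hρ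
  obtain ⟨ρ, hρ0, hρ⟩ := hρ.exists
  have hbr : ∀ᶠ z₀ in 𝓝[≠] a, ∀ b : F, ∃ (I : Finset ℂ) (f : I → ℂ → ℂ),
      (∀ i, AnalyticAt ℂ (f i) z₀) ∧ (Function.Injective fun i => f i z₀) ∧
      ∀ᶠ z in 𝓝 z₀, {w | w ∈ Metric.ball (b : ℂ) ρ ∧ ∀ k, g b k (z, w) = 0} =
        range fun i => f i z := by
    refine eventually_all.2 fun b => eventually_exists_branches_commonZeros (hU b) (hg b) hρ0
      (fun w hw => ((hρ b).1 hw).1) (k₀ := k b) fun w hw => ?_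
    refine ((hρ b).1 (Metric.sphere_subset_closedBall hw)).2 ?_
    rintro rfl
    rw [Metric.mem_sphere, dist_self] at hw
    exact hρ0.ne hw
  have hsub : ∀ᶠ z in 𝓝 a, corrMap V z ⊆ ⋃ b : F, Metric.ball (b : ℂ) ρ :=
    hV.eventually_corrMap_subset hD₁ ha (isOpen_iUnion fun _ => Metric.isOpen_ball)
      fun w hw => mem_iUnion.2 ⟨⟨w, hfin.mem_toFinset.2 hw⟩, Metric.mem_ball_self hρ0⟩
  have hin : ∀ᶠ z in 𝓝 a, ∀ b : F, ∀ w ∈ Metric.closedBall (b : ℂ) ρ, (z, w) ∈ U b :=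
    eventually_all.2 fun b =>
      (isCompact_closedBall (b : ℂ) ρ).eventually_forall_of_forall_eventually fun w hw =>
        (hU b).mem_nhds ((hρ b).1 hw).1
  filter_upwards [hbr, nhdsWithin_le_nhds (eventually_eventually_nhds.2 (hsub.and hin))]
    with z₀ h1 h2
  choose I f hfa hfi hf using h1
  have hballf : ∀ᶠ z in 𝓝 z₀, ∀ b (i : I b), f b i z ∈ Metric.ball (b : ℂ) ρ := by
    filter_upwards [eventually_all.2 hf] with z hz b i
    exact ((hz b).superset (mem_range_self i)).1
  refine HasDisjointBranches.of_finite (ι := Σ b : F, I b) (fun x => f x.1 x.2)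
    (fun x => hfa x.1 x.2) ?_ ?_
  · rintro ⟨b, i⟩ ⟨b', i'⟩ h
    have hb : b' = b := by
      by_contra hne
      have h3 := (hρ b).2 b' hne
      have h4 := hballf.self_of_nhds b i
      have h5 := hballf.self_of_nhds b' i'
      dsimp only at h
      rw [h] at h4
      rw [Metric.mem_ball] at h4 h5
      have h6 := dist_triangle_left (b' : ℂ) b (f b' i' z₀)
      linarith
    subst hb
    exact congrArg (Sigma.mk b') (hfi b' h)
  · filter_upwards [eventually_all.2 hf, h2] with z hz hz2
    ext w
    constructor
    · intro hw
      obtain ⟨b, hb⟩ := mem_iUnion.1 (hz2.1 hw)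
      have hm : (z, w) ∈ V ∩ U b := ⟨hw, hz2.2 b w (Metric.ball_subset_closedBall hb)⟩
      rw [hVU] at hm
      obtain ⟨i, hi⟩ := (hz b).subset ⟨hb, hm.2⟩
      exact ⟨⟨b, i⟩, hi⟩
    · rintro ⟨⟨b, i⟩, rfl⟩
      have h3 := (hz b).superset (mem_range_self i)
      have hm : (z, f b i z) ∈ V ∩ U b := by
        rw [hVU]
        exact ⟨hz2.2 b _ (Metric.ball_subset_closedBall h3.1), h3.2⟩
      exact hm.1

/-- A punctured disc is the image of a half-plane under a translate of the exponential. -/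
theorem isPreconnected_puncturedBall (a : ℂ) {ε : ℝ} (hε : 0 < ε) :
    IsPreconnected (Metric.ball a ε \ {a}) := by
  have h : Metric.ball a ε \ {a} = (fun x => a + Complex.exp x) '' {x | x.re < Real.log ε} := by
    ext z
    simp only [Set.mem_sdiff, Metric.mem_ball, mem_singleton_iff, mem_image, mem_ofPred_eq,
      dist_eq_norm]
    constructor
    · rintro ⟨h1, h2⟩
      have h3 : z - a ≠ 0 := sub_ne_zero.2 h2
      refine ⟨Complex.log (z - a), ?_, by rw [Complex.exp_log h3]; ring⟩
      rw [Complex.log_re]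
      exact Real.log_lt_log (norm_pos_iff.2 h3) h1
    · rintro ⟨x, hx, rfl⟩
      refine ⟨?_, by simp [Complex.exp_ne_zero]⟩
      rw [add_sub_cancel_left, Complex.norm_exp]
      exact (Real.lt_log_iff_exp_lt hε).1 hx
  rw [h]
  exact (convex_halfSpace_re_lt _).isPreconnected.image _ (by fun_prop)

theorem continuousAt_of_eventually_eq {α : Type*} {k : ℂ → α} [TopologicalSpace α] {a : ℂ}
    (h : ∀ᶠ z in 𝓝 a, k z = k a) : ContinuousAt k a :=
  continuousAt_const.congr (h.mono fun _ hz => hz.symm)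

theorem HasDisjointBranches.eventually_ncard_eq {Φ : ℂ → Set ℂ} {z₀ : ℂ}
    (h : HasDisjointBranches Φ z₀) : ∀ᶠ z in 𝓝 z₀, (Φ z).ncard = (Φ z₀).ncard := by
  obtain ⟨n, f, hf, hinj, hΦ⟩ := h
  have key : ∀ᶠ z in 𝓝 z₀, (Φ z).ncard = n := by
    filter_upwards [hΦ, eventually_injective_of_continuousAt (fun i => (hf i).continuousAt) hinj]
      with z h1 h2
    rw [h1, ← image_univ, ncard_image_of_injective _ h2, ncard_univ, Nat.card_eq_fintype_card,
      Fintype.card_fin]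
  filter_upwards [key] with z hz
  rw [hz, key.self_of_nhds]

/-- Branches exist off a discrete set; their number is constant because the domain stays
connected, locally, after removing a point. -/
theorem IsProperHolomorphicCorrespondence.exists_hasBranchesOff (hD₁ : IsPlanarDomain D₁)
    (hD₂ : IsPlanarDomain D₂) (hV : IsProperHolomorphicCorrespondence D₁ D₂ V) :
    ∃ S p, HasBranchesOff D₁ (corrMap V) S p := by
  have hev := fun a ha => hV.eventually_hasDisjointBranches (a := a) hD₁.1 hD₂ ha
  have hconst : ∀ a, ∃ k : ℕ, a ∈ D₁ → ∀ᶠ z in 𝓝[≠] a, (corrMap V z).ncard = k := by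
    intro a
    by_cases ha : a ∈ D₁
    · obtain ⟨ε, hε, hb⟩ := Metric.mem_nhdsWithin_iff.1 (hev a ha)
      have hpre := isPreconnected_puncturedBall a hε
      obtain ⟨z₁, hz₁⟩ : ∃ z₁, z₁ ∈ Metric.ball a ε \ {a} := by
        have : ∀ᶠ z in 𝓝[≠] a, z ∈ Metric.ball a ε \ {a} :=
          inter_mem (nhdsWithin_le_nhds (Metric.ball_mem_nhds a hε)) self_mem_nhdsWithin
        exact this.exists
      refine ⟨(corrMap V z₁).ncard, fun _ => ?_⟩
      have hcont : ContinuousOn (fun z => (corrMap V z).ncard) (Metric.ball a ε \ {a}) := by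
        intro z hz
        refine ContinuousAt.continuousWithinAt ?_
        exact continuousAt_of_eventually_eq (hb hz).eventually_ncard_eq
      filter_upwards [nhdsWithin_le_nhds (Metric.ball_mem_nhds a hε), self_mem_nhdsWithin]
        with z h1 h2
      exact hpre.constant hcont ⟨h1, h2⟩ hz₁
    · exact ⟨0, fun h => absurd h ha⟩
  choose k hk using hconst
  have hkc : ContinuousOn k D₁ := by
    intro a ha
    refine ContinuousAt.continuousWithinAt (continuousAt_of_eventually_eq ?_)
    have h1 := hk a ha
    rw [eventually_nhdsWithin_iff] at h1
    filter_upwards [eventually_eventually_nhds.2 h1, hD₁.1.mem_nhds ha] with z hz hzD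
    by_cases hza : z = a
    · rw [hza]
    · have h2 : ∀ᶠ x in 𝓝[≠] z, x ≠ a :=
        nhdsWithin_le_nhds (isOpen_ne.mem_nhds hza)
      obtain ⟨x, h3, h4, h5⟩ := ((hk z hzD).and (h2.and (nhdsWithin_le_nhds hz))).exists
      rw [← h3, h5 h4]
  obtain ⟨a₀, ha₀⟩ := hD₁.2.nonempty
  refine ⟨{z ∈ D₁ | ¬ HasDisjointBranches (corrMap V) z}, k a₀, fun z hz => hz.1, fun a ha => ?_,
    fun a ha => ?_⟩
  · filter_upwards [hev a ha] with z hz h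
    exact h.2 hz
  · have hbr : HasDisjointBranches (corrMap V) a := by
      by_contra h
      exact ha.2 ⟨ha.1, h⟩
    have hcard : (corrMap V a).ncard = k a₀ := by
      obtain ⟨z, h1, h2⟩ :=
        ((hk a ha.1).and (nhdsWithin_le_nhds hbr.eventually_ncard_eq)).exists
      rw [← h2, h1, hD₁.2.isPreconnected.constant hkc ha.1 ha₀]
    obtain ⟨n, f, hf, hinj, hΦ⟩ := hbr
    have hn : n = k a₀ := by
      rw [← hcard, hΦ.self_of_nhds, ← image_univ, ncard_image_of_injective _ hinj, ncard_univ,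
        Nat.card_eq_fintype_card, Fintype.card_fin]
    subst hn
    exact ⟨f, IsLocalBranches.of_injective hf hinj hΦ⟩

end Fibres

/-! ### The reduced Bergman space -/

theorem enorm_le_lintegral_circle {f : ℂ → ℂ} {ζ : ℂ} {R r : ℝ}
    (hf : DifferentiableOn ℂ f (Metric.ball ζ R)) (hr : 0 < r) (hrR : r < R) :
    ENNReal.ofReal (2 * Real.pi) * ‖f ζ‖ₑ ≤
      ∫⁻ θ in Ioo (-Real.pi) Real.pi, ‖f (circleMap ζ r θ)‖ₑ := by
  have hd : DiffContOnCl ℂ f (Metric.ball ζ |r|) := by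
    rw [abs_of_pos hr]
    exact hf.diffContOnCl_ball (Metric.closedBall_subset_ball hrR)
  have h1 := hd.circleAverage
  rw [Real.circleAverage_def] at h1
  have h2 : ∫ θ in (-Real.pi)..Real.pi, f (circleMap ζ r θ) = (2 * Real.pi) • f ζ := by
    have hper : Function.Periodic (fun θ => f (circleMap ζ r θ)) (2 * Real.pi) := fun θ => by
      simp only [periodic_circleMap ζ r θ]
    have h3 := hper.intervalIntegral_add_eq (-Real.pi) 0
    rw [zero_add, show -Real.pi + 2 * Real.pi = Real.pi by ring] at h3
    rw [h3, ← h1, smul_inv_smul₀ (by positivity)]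
  rw [intervalIntegral.integral_of_le (by linarith [Real.pi_pos]),
    integral_Ioc_eq_integral_Ioo] at h2
  have h4 := enorm_integral_le_lintegral_enorm (μ := volume.restrict (Ioo (-Real.pi) Real.pi))
    (fun θ => f (circleMap ζ r θ))
  rw [h2, enorm_smul] at h4
  rwa [Real.enorm_eq_ofReal (by positivity)] at h4

/-- Point evaluations are bounded by the `L²` norm on a disc: average the mean value property of
`f ^ 2` over the circles of radius between `R / 2` and `R`. -/
theorem enorm_sq_le_lintegral_ball {f : ℂ → ℂ} {ζ : ℂ} {R : ℝ} (hR : 0 < R)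
    (hf : DifferentiableOn ℂ f (Metric.ball ζ R)) :
    ENNReal.ofReal (R ^ 2) * ‖f ζ‖ₑ ^ 2 ≤ ∫⁻ z in Metric.ball ζ R, ‖f z‖ₑ ^ 2 := by
  set G : ℂ → ENNReal := (Metric.ball ζ R).indicator fun z => ‖f z‖ₑ ^ 2 with hG
  have hGm : Measurable G := by
    have : ContinuousOn (fun z => ‖f z‖ₑ ^ 2) (Metric.ball ζ R) :=
      (ENNReal.continuous_pow 2).comp_continuousOn hf.continuousOn.enorm
    refine measurable_of_restrict_of_restrict_compl (s := Metric.ball ζ R)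
      Metric.isOpen_ball.measurableSet ?_ ?_
    · have h : (Metric.ball ζ R).domRestrict G = (Metric.ball ζ R).domRestrict fun z => ‖f z‖ₑ ^ 2 :=
        funext fun x => indicator_of_mem x.2 fun z => ‖f z‖ₑ ^ 2
      rw [h]
      exact (continuousOn_iff_continuous_domRestrict.1 this).measurable
    · have h : (Metric.ball ζ R)ᶜ.domRestrict G = fun _ => 0 :=
        funext fun x => indicator_of_notMem x.2 fun z => ‖f z‖ₑ ^ 2
      rw [h]
      exact measurable_const
  have hpol : ∀ p : ℝ × ℝ, ζ + Complex.polarCoord.symm p = circleMap ζ p.1 p.2 := by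
    intro p
    rw [Complex.polarCoord_symm_apply, circleMap, Complex.exp_mul_I, Complex.ofReal_cos,
      Complex.ofReal_sin]
  have h1 : ∫⁻ z in Metric.ball ζ R, ‖f z‖ₑ ^ 2 =
      ∫⁻ p in Ioi (0 : ℝ) ×ˢ Ioo (-Real.pi) Real.pi,
        ENNReal.ofReal p.1 * G (circleMap ζ p.1 p.2) := by
    rw [← lintegral_indicator Metric.isOpen_ball.measurableSet,
      ← lintegral_add_left_eq_self _ ζ, ← Complex.lintegral_comp_polarCoord_symm]
    simp only [hpol, smul_eq_mul]
    rfl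
  have hcm : Measurable fun p : ℝ × ℝ => ENNReal.ofReal p.1 * G (circleMap ζ p.1 p.2) := by
    have hc : Continuous fun p : ℝ × ℝ => circleMap ζ p.1 p.2 := by
      simp only [circleMap]; fun_prop
    exact (measurable_fst.ennreal_ofReal).mul (hGm.comp hc.measurable)
  rw [h1]
  have hsub : Ioo (R / 2) R ×ˢ Ioo (-Real.pi) Real.pi ⊆ Ioi (0 : ℝ) ×ˢ Ioo (-Real.pi) Real.pi :=
    prod_mono (fun r hr => lt_trans (half_pos hR) hr.1) Subset.rfl
  have hin : ∀ r ∈ Ioo (R / 2) R, ENNReal.ofReal (R / 2) *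
      (ENNReal.ofReal (2 * Real.pi) * ‖f ζ‖ₑ ^ 2) ≤
        ∫⁻ θ in Ioo (-Real.pi) Real.pi, ENNReal.ofReal r * G (circleMap ζ r θ) := by
    intro r hr
    have hr0 : 0 < r := (half_pos hR).trans hr.1
    have hmem : ∀ θ, circleMap ζ r θ ∈ Metric.ball ζ R := fun θ => by
      rw [Metric.mem_ball, dist_eq_norm, circleMap_sub_center, norm_circleMap_zero,
        abs_of_pos hr0]
      exact hr.2
    have hGv : ∀ θ, G (circleMap ζ r θ) = ‖f (circleMap ζ r θ) ^ 2‖ₑ := fun θ => by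
      rw [hG, indicator_of_mem (hmem θ), enorm_pow]
    simp only [hGv]
    have h3 := enorm_le_lintegral_circle (f := fun z => f z ^ 2) (hf.pow 2) hr0 hr.2
    rw [lintegral_const_mul' _ _ ENNReal.ofReal_ne_top]
    rw [enorm_pow] at h3
    gcongr
    exact hr.1.le
  calc ENNReal.ofReal (R ^ 2) * ‖f ζ‖ₑ ^ 2
      ≤ (ENNReal.ofReal (R / 2) * (ENNReal.ofReal (2 * Real.pi) * ‖f ζ‖ₑ ^ 2)) *
          ENNReal.ofReal (R / 2) := by
        rw [← mul_assoc, mul_right_comm, ← ENNReal.ofReal_mul (by positivity),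
          ← ENNReal.ofReal_mul (by positivity)]
        gcongr
        -- the constant is `π R² / 2`
        nlinarith [Real.pi_gt_three, sq_nonneg R]
    _ = ∫⁻ r in Ioo (R / 2) R,
          ENNReal.ofReal (R / 2) * (ENNReal.ofReal (2 * Real.pi) * ‖f ζ‖ₑ ^ 2) := by
        rw [setLIntegral_const, Real.volume_Ioo]
        congr 2
        ring
    _ ≤ ∫⁻ r in Ioo (R / 2) R, ∫⁻ θ in Ioo (-Real.pi) Real.pi,
          ENNReal.ofReal r * G (circleMap ζ r θ) :=
        setLIntegral_mono' measurableSet_Ioo hin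
    _ = ∫⁻ p in Ioo (R / 2) R ×ˢ Ioo (-Real.pi) Real.pi,
          ENNReal.ofReal p.1 * G (circleMap ζ p.1 p.2) := by
        rw [Measure.volume_eq_prod, ← Measure.prod_restrict, lintegral_prod _ hcm.aemeasurable]
    _ ≤ _ := lintegral_mono_set hsub

section Bergman

variable {D : Set ℂ}

theorem DifferentiableOn.aestronglyMeasurable_restrict (hD : IsOpen D) {f : ℂ → ℂ}
    (hf : DifferentiableOn ℂ f D) : AEStronglyMeasurable f (volume.restrict D) :=
  hf.continuousOn.aestronglyMeasurable hD.measurableSet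

theorem reducedBergmanSpace.memLp (hD : IsOpen D) {f : ℂ → ℂ} (hf : f ∈ reducedBergmanSpace D) :
    MemLp f 2 (volume.restrict D) :=
  (memLp_two_iff_integrable_sq_norm (hf.1.aestronglyMeasurable_restrict hD)).2 hf.2.2

theorem mem_reducedBergmanSpace_of_memLp (hD : IsOpen D) {f : ℂ → ℂ}
    (hf : DifferentiableOn ℂ f D)
    (hp : ∃ g : ℂ → ℂ, DifferentiableOn ℂ g D ∧ ∀ z ∈ D, HasDerivAt g (f z) z)
    (h : MemLp f 2 (volume.restrict D)) : f ∈ reducedBergmanSpace D :=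
  ⟨hf, hp, (memLp_two_iff_integrable_sq_norm
    (DifferentiableOn.aestronglyMeasurable_restrict hD hf)).1 h⟩

theorem reducedBergmanSpace.add_mem (hD : IsOpen D) {f g : ℂ → ℂ} (hf : f ∈ reducedBergmanSpace D)
    (hg : g ∈ reducedBergmanSpace D) : f + g ∈ reducedBergmanSpace D := by
  obtain ⟨F, hF, hF'⟩ := hf.2.1
  obtain ⟨G, hG, hG'⟩ := hg.2.1
  exact mem_reducedBergmanSpace_of_memLp hD (hf.1.add hg.1)
    ⟨F + G, hF.add hG, fun z hz => (hF' z hz).add (hG' z hz)⟩ ((memLp hD hf).add (memLp hD hg))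

theorem reducedBergmanSpace.smul_mem (hD : IsOpen D) {f : ℂ → ℂ} (c : ℂ)
    (hf : f ∈ reducedBergmanSpace D) : c • f ∈ reducedBergmanSpace D := by
  obtain ⟨F, hF, hF'⟩ := hf.2.1
  exact mem_reducedBergmanSpace_of_memLp hD (hf.1.const_smul c)
    ⟨c • F, hF.const_smul c, fun z hz => (hF' z hz).const_smul c⟩ ((memLp hD hf).const_smul c)

/-- The reduced Bergman space as a subspace of `L²(D)`. -/
noncomputable def reducedBergmanSubmodule (hD : IsOpen D) :
    Submodule ℂ (Lp ℂ 2 (volume.restrict D)) where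
  carrier := {φ | ∃ f ∈ reducedBergmanSpace D, φ =ᵐ[volume.restrict D] f}
  add_mem' := by
    rintro φ ψ ⟨f, hf, hφ⟩ ⟨g, hg, hψ⟩
    exact ⟨f + g, reducedBergmanSpace.add_mem hD hf hg, (Lp.coeFn_add φ ψ).trans (hφ.add hψ)⟩
  zero_mem' := ⟨0, mem_reducedBergmanSpace_of_memLp hD (differentiableOn_const 0)
    ⟨0, differentiableOn_const 0, fun z _ => hasDerivAt_const z 0⟩ MemLp.zero, Lp.coeFn_zero ..⟩
  smul_mem' := by
    rintro c φ ⟨f, hf, hφ⟩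
    exact ⟨c • f, reducedBergmanSpace.smul_mem hD c hf,
      (Lp.coeFn_smul c φ).trans (hφ.const_smul c)⟩

theorem enorm_sq_le_lintegral_of_ball_subset {f : ℂ → ℂ} (hf : DifferentiableOn ℂ f D) {ζ : ℂ}
    {R : ℝ} (hR : 0 < R) (hRD : Metric.ball ζ R ⊆ D) :
    ENNReal.ofReal (R ^ 2) * ‖f ζ‖ₑ ^ 2 ≤ ∫⁻ z in D, ‖f z‖ₑ ^ 2 :=
  (enorm_sq_le_lintegral_ball hR (hf.mono hRD)).trans (lintegral_mono_set hRD)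

theorem mul_norm_apply_le_norm_of_ae_eq (φ : Lp ℂ 2 (volume.restrict D)) {f : ℂ → ℂ}
    (hf : DifferentiableOn ℂ f D) (h : φ =ᵐ[volume.restrict D] f) {ζ : ℂ} {R : ℝ} (hR : 0 < R)
    (hRD : Metric.ball ζ R ⊆ D) : R * ‖f ζ‖ ≤ ‖φ‖ := by
  have h1 := enorm_sq_le_lintegral_of_ball_subset hf hR hRD
  have h2 : ∫⁻ z in D, ‖f z‖ₑ ^ 2 = ‖φ‖ₑ ^ 2 := by
    rw [Lp.enorm_def, eLpNorm_congr_ae h, eLpNorm_eq_lintegral_rpow_enorm_toReal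
      (by norm_num) (by norm_num), ← ENNReal.rpow_natCast, ← ENNReal.rpow_mul]
    simp
  rw [h2, ← enorm_pow, ← ofReal_norm, ← ofReal_norm, ← ENNReal.ofReal_pow (norm_nonneg _),
    ← ENNReal.ofReal_mul (by positivity), ENNReal.ofReal_le_ofReal_iff (by positivity),
    norm_pow, ← mul_pow] at h1
  exact le_of_sq_le_sq h1 (norm_nonneg _)

/-- Locally uniform limits of functions with primitives have primitives: normalise the primitives at
one point; the set where they converge is open and closed in `D`. -/
theorem exists_primitive_of_tendstoLocallyUniformlyOn (hD : IsPlanarDomain D) {f : ℕ → ℂ → ℂ}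
    {F : ℂ → ℂ}
    (hp : ∀ n, ∃ g : ℂ → ℂ, DifferentiableOn ℂ g D ∧ ∀ z ∈ D, HasDerivAt g (f n z) z)
    (hF : TendstoLocallyUniformlyOn f F atTop D)
    (hball : ∀ z ∈ D, ∃ r > 0, Metric.ball z r ⊆ D ∧
      UniformCauchySeqOn f atTop (Metric.ball z r)) :
    ∃ g : ℂ → ℂ, DifferentiableOn ℂ g D ∧ ∀ z ∈ D, HasDerivAt g (F z) z := by
  choose g hg hg' using hp
  obtain ⟨z₀, hz₀⟩ := hD.2.nonempty
  let G : ℕ → ℂ → ℂ := fun n z => g n z - g n z₀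
  have hG : ∀ n, ∀ z ∈ D, HasDerivAt (G n) (f n z) z := fun n z hz => (hg' n z hz).sub_const _
  let E : Set ℂ := {z ∈ D | Cauchy (map (fun n => G n z) atTop)}
  -- convergence spreads from the centre of a small disc to the whole disc
  have hspread : ∀ x r, Metric.ball x r ⊆ D → UniformCauchySeqOn f atTop (Metric.ball x r) →
      x ∈ E → Metric.ball x r ⊆ E := by
    intro x r hrD hu hx y hy
    have h1 := uniformCauchySeqOn_ball_of_deriv hu (fun n y hy => hG n y (hrD hy)) hx.2
    exact ⟨hrD hy, h1.cauchy_map hy⟩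
  have hEopen : IsOpen E := by
    rw [isOpen_iff_mem_nhds]
    intro x hx
    obtain ⟨r, hr, hrD, hu⟩ := hball x hx.1
    exact mem_of_superset (Metric.ball_mem_nhds x hr) (hspread x r hrD hu hx)
  have hE : D ⊆ E := by
    refine hD.2.isPreconnected.subset_of_closure_inter_subset hEopen ⟨z₀, hz₀, hz₀, ?_⟩ ?_
    · simp only [G, sub_self]
      exact (tendsto_const_nhds (x := (0 : ℂ)) (f := (atTop : Filter ℕ))).cauchy_map
    · rintro x ⟨hx, hxD⟩
      obtain ⟨r, hr, hrD, hu⟩ := hball x hxD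
      obtain ⟨y, hy, hxy⟩ := Metric.mem_closure_iff.1 hx (r / 2) (half_pos hr)
      have hsub : Metric.ball y (r / 2) ⊆ Metric.ball x r := by
        refine Metric.ball_subset_ball' ?_
        rw [dist_comm] at hxy
        linarith
      exact hspread y (r / 2) (hsub.trans hrD) (hu.mono hsub) hy hxy
  have hlim : ∀ z, ∃ y, z ∈ D → Tendsto (fun n => G n z) atTop (𝓝 y) := by
    intro z
    by_cases hz : z ∈ D
    · obtain ⟨y, hy⟩ := CompleteSpace.complete (hE hz).2
      exact ⟨y, fun _ => hy⟩
    · exact ⟨0, fun h => absurd h hz⟩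
  choose G' hG' using hlim
  have hder : ∀ z ∈ D, HasDerivAt G' (F z) z := fun z hz =>
    hasDerivAt_of_tendstoLocallyUniformlyOn hD.1 hF (Eventually.of_forall hG) hG' hz
  exact ⟨G', fun z hz => (hder z hz).differentiableAt.differentiableWithinAt, hder⟩

/-- Convergence in `L²(D)` of holomorphic functions is locally uniform, so that limits are holomorphic
and still have primitives. -/
theorem isClosed_reducedBergmanSubmodule (hD : IsPlanarDomain D) :
    IsClosed (reducedBergmanSubmodule hD.1 : Set (Lp ℂ 2 (volume.restrict D))) := by
  refine IsSeqClosed.isClosed fun φ ψ hφ hlim => ?_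
  choose f hf hφf using hφ
  have hball : ∀ z ∈ D, ∃ r > 0, Metric.ball z r ⊆ D ∧
      UniformCauchySeqOn f atTop (Metric.ball z r) := by
    intro z hz
    obtain ⟨R, hR, hRD⟩ := Metric.isOpen_iff.1 hD.1 z hz
    have hsub : ∀ x ∈ Metric.ball z (R / 2), Metric.ball x (R / 2) ⊆ D := by
      intro x hx
      refine (Metric.ball_subset_ball' ?_).trans hRD
      rw [Metric.mem_ball] at hx
      linarith
    refine ⟨R / 2, half_pos hR, (Metric.ball_subset_ball (half_le_self hR.le)).trans hRD, ?_⟩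
    rw [Metric.uniformCauchySeqOn_iff]
    intro ε hε
    obtain ⟨N, hN⟩ := Metric.cauchySeq_iff.1 hlim.cauchySeq (R / 2 * ε) (by positivity)
    refine ⟨N, fun m hm n hn x hx => ?_⟩
    have h1 := mul_norm_apply_le_norm_of_ae_eq (φ m - φ n) ((hf m).1.sub (hf n).1)
      ((Lp.coeFn_sub _ _).trans ((hφf m).sub (hφf n))) (half_pos hR) (hsub x hx)
    have h2 := hN m hm n hn
    rw [dist_eq_norm] at h2 ⊢
    exact lt_of_mul_lt_mul_left (h1.trans_lt h2) (half_pos hR).le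
  have hlim' : ∀ z, ∃ y, z ∈ D → Tendsto (fun n => f n z) atTop (𝓝 y) := by
    intro z
    by_cases hz : z ∈ D
    · obtain ⟨r, hr, -, hu⟩ := hball z hz
      obtain ⟨y, hy⟩ := CompleteSpace.complete (hu.cauchy_map (Metric.mem_ball_self hr))
      exact ⟨y, fun _ => hy⟩
    · exact ⟨0, fun h => absurd h hz⟩
  choose F hF using hlim'
  have hloc : TendstoLocallyUniformlyOn f F atTop D := by
    intro u hu z hz
    obtain ⟨r, hr, hrD, hcau⟩ := hball z hz
    exact ⟨_, nhdsWithin_le_nhds (Metric.ball_mem_nhds z hr),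
      hcau.tendstoUniformlyOn_of_tendsto (fun x hx => hF x (hrD hx)) u hu⟩
  have hFd : DifferentiableOn ℂ F D :=
    hloc.differentiableOn (Eventually.of_forall fun n => (hf n).1) hD.1
  have hae : ψ =ᵐ[volume.restrict D] F := by
    have hm : TendstoInMeasure (volume.restrict D) (fun n => (φ n : ℂ → ℂ)) atTop ψ :=
      tendstoInMeasure_of_tendsto_Lp hlim
    obtain ⟨ns, hns, hsub⟩ := hm.exists_seq_tendsto_ae
    have hall : ∀ᵐ z ∂volume.restrict D, ∀ n, φ n z = f n z := ae_all_iff.2 hφf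
    filter_upwards [hsub, hall, ae_restrict_mem hD.1.measurableSet] with z h1 h2 hz
    simp only [h2] at h1
    exact tendsto_nhds_unique h1 ((hF z hz).comp hns.tendsto_atTop)
  refine ⟨F, mem_reducedBergmanSpace_of_memLp hD.1 hFd
    (exists_primitive_of_tendstoLocallyUniformlyOn hD (fun n => (hf n).2.1) hloc hball)
    ((memLp_congr_ae hae).1 (Lp.memLp ψ)), hae⟩

/-- The kernel `K(·, ζ)` is the Riesz representative of the evaluation at `ζ`, which is bounded on the
closed subspace `reducedBergmanSubmodule` of `L²(D)`. -/
theorem exists_isReducedBergmanKernel (hD : IsPlanarDomain D) :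
    ∃ K, IsReducedBergmanKernel D K := by
  have : CompleteSpace (reducedBergmanSubmodule hD.1) :=
    (isClosed_reducedBergmanSubmodule hD).completeSpace_coe
  have hex : ∀ ζ, ∃ k : ℂ → ℂ, ζ ∈ D → k ∈ reducedBergmanSpace D ∧
      ∀ f ∈ reducedBergmanSpace D, f ζ = ∫ z in D, f z * conj (k z) := by
    intro ζ
    by_cases hζ : ζ ∈ D
    swap
    · exact ⟨0, fun h => absurd h hζ⟩
    obtain ⟨R, hR, hRD⟩ := Metric.isOpen_iff.1 hD.1 ζ hζ
    have hrep : ∀ φ : reducedBergmanSubmodule hD.1, ∃ f ∈ reducedBergmanSpace D,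
        φ.1 =ᵐ[volume.restrict D] f := fun φ => φ.2
    choose rep hrep hrepe using hrep
    have huniq : ∀ (φ : reducedBergmanSubmodule hD.1) (f : ℂ → ℂ), DifferentiableOn ℂ f D →
        φ.1 =ᵐ[volume.restrict D] f → rep φ ζ = f ζ := fun φ f hf h =>
      Measure.eqOn_open_of_ae_eq ((hrepe φ).symm.trans h) hD.1 (hrep φ).1.continuousOn
        hf.continuousOn hζ
    let L₀ : reducedBergmanSubmodule hD.1 →ₗ[ℂ] ℂ :=
      { toFun := fun φ => rep φ ζ
        map_add' := fun φ ψ => huniq (φ + ψ) (rep φ + rep ψ) ((hrep φ).1.add (hrep ψ).1)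
          ((Lp.coeFn_add φ.1 ψ.1).trans ((hrepe φ).add (hrepe ψ)))
        map_smul' := fun c φ => huniq (c • φ) (c • rep φ) ((hrep φ).1.const_smul c)
          ((Lp.coeFn_smul c φ.1).trans ((hrepe φ).const_smul c)) }
    let L : reducedBergmanSubmodule hD.1 →L[ℂ] ℂ := L₀.mkContinuous R⁻¹ fun φ => by
      rw [← div_eq_inv_mul, le_div_iff₀' hR]
      exact mul_norm_apply_le_norm_of_ae_eq φ.1 (hrep φ).1 (hrepe φ) hR hRD
    let k := (InnerProductSpace.toDual ℂ (reducedBergmanSubmodule hD.1)).symm L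
    refine ⟨rep k, fun _ => ⟨hrep k, fun f hf => ?_⟩⟩
    have hfp := reducedBergmanSpace.memLp hD.1 hf
    let φ : reducedBergmanSubmodule hD.1 := ⟨hfp.toLp f, f, hf, hfp.coeFn_toLp⟩
    have h1 : L φ = f ζ := huniq φ f hf.1 hfp.coeFn_toLp
    rw [← h1, ← InnerProductSpace.toDual_symm_apply (𝕜 := ℂ) (x := φ) (y := L),
      Submodule.coe_inner, L2.inner_def]
    refine integral_congr_ae ?_
    filter_upwards [hrepe k, hfp.coeFn_toLp] with z h2 h3
    rw [← h2, ← h3]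
    exact RCLike.inner_apply _ _
  choose k hk using hex
  exact ⟨fun z ζ => k ζ z, fun ζ hζ => hk ζ hζ⟩

theorem isReducedBergmanKernel_reducedBergmanKernel (hD : IsPlanarDomain D) :
    IsReducedBergmanKernel D (reducedBergmanKernel D) := by
  have h := exists_isReducedBergmanKernel hD
  rw [reducedBergmanKernel, dif_pos h]
  exact h.choose_spec

theorem IsReducedBergmanKernel.conj_symm {K : ℂ → ℂ → ℂ} (hK : IsReducedBergmanKernel D K)
    {z ζ : ℂ} (hz : z ∈ D) (hζ : ζ ∈ D) : conj (K ζ z) = K z ζ := by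
  rw [(hK ζ hζ).2 _ (hK z hz).1, (hK z hz).2 _ (hK ζ hζ).1, ← integral_conj]
  simp only [map_mul, Complex.conj_conj, mul_comm]

/-- The squared `L²` norm of `K(·, ζ)` is `K(ζ, ζ)`, and point evaluation bounds this value. -/
theorem IsReducedBergmanKernel.lintegral_enorm_sq_le {K : ℂ → ℂ → ℂ}
    (hK : IsReducedBergmanKernel D K) {ζ : ℂ} {R : ℝ} (hR : 0 < R) (hRD : Metric.ball ζ R ⊆ D) :
    ENNReal.ofReal (R ^ 2) * ∫⁻ z in D, ‖K z ζ‖ₑ ^ 2 ≤ 1 := by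
  have hζ : ζ ∈ D := hRD (Metric.mem_ball_self hR)
  have hmem := (hK ζ hζ).1
  have h1 := enorm_sq_le_lintegral_of_ball_subset hmem.1 hR hRD
  have h2 : ∫⁻ z in D, ‖K z ζ‖ₑ ^ 2 = ‖K ζ ζ‖ₑ := by
    have h3 : K ζ ζ = ((∫ z in D, ‖K z ζ‖ ^ 2 : ℝ) : ℂ) := by
      conv_lhs => rw [(hK ζ hζ).2 _ hmem]
      rw [← integral_complex_ofReal]
      refine integral_congr_ae (Eventually.of_forall fun z => ?_)
      simp only [Complex.mul_conj, Complex.normSq_eq_norm_sq]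
    rw [h3, ← ofReal_norm, Complex.norm_real, Real.norm_eq_abs,
      abs_of_nonneg (integral_nonneg fun _ => by positivity),
      ofReal_integral_eq_lintegral_ofReal hmem.2.2 (Eventually.of_forall fun _ => by positivity)]
    refine lintegral_congr fun z => ?_
    rw [← ofReal_norm, ENNReal.ofReal_pow (norm_nonneg _)]
  rw [h2] at h1 ⊢
  by_cases h0 : ‖K ζ ζ‖ₑ = 0
  · simp [h0]
  · rw [sq ‖K ζ ζ‖ₑ, ← mul_assoc] at h1
    rwa [← ENNReal.mul_le_mul_iff_left h0 enorm_ne_top, one_mul]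

end Bergman

/-! ### Families of local branches -/

section Branches

variable {Φ : ℂ → Set ℂ} {a : ℂ} {n : ℕ} {f f' : Fin n → ℂ → ℂ}

theorem AnalyticAt.eventually_ne_of_not_eventuallyEq {u v : ℂ → ℂ} (hu : AnalyticAt ℂ u a)
    (hv : AnalyticAt ℂ v a) (h : ¬ u =ᶠ[𝓝 a] v) : ∀ᶠ z in 𝓝[≠] a, u z ≠ v z := by
  by_contra hcon
  refine h ((hu.frequently_eq_iff_eventually_eq hv).1 ?_)
  exact (not_eventually.1 hcon).mono fun z hz => not_not.1 hz

theorem IsLocalBranches.eventually_injective (h : IsLocalBranches Φ a f) :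
    ∀ᶠ z in 𝓝[≠] a, Function.Injective fun i => f i z := by
  have : ∀ᶠ z in 𝓝[≠] a, ∀ i j, i ≠ j → f i z ≠ f j z := by
    refine eventually_all.2 fun i => eventually_all.2 fun j => ?_
    by_cases hij : i = j
    · simp [hij]
    · filter_upwards [(h.1 i).eventually_ne_of_not_eventuallyEq (h.1 j) (h.2.2 i j hij)]
        with z hz _ using hz
  filter_upwards [this] with z hz i j hij
  by_contra hne
  exact hz i j hne hij

/-- Branches at `a` are branches at all nearby points. -/
theorem IsLocalBranches.eventually (h : IsLocalBranches Φ a f) :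
    ∀ᶠ z in 𝓝 a, IsLocalBranches Φ z f := by
  have h1 : ∀ᶠ z in 𝓝 a, ∀ i, AnalyticAt ℂ (f i) z :=
    eventually_all.2 fun i => (h.1 i).eventually_analyticAt
  have h2 := eventually_eventually_nhds.2 h.2.1
  have h3 := eventually_nhdsWithin_iff.1 h.eventually_injective
  filter_upwards [h1, h2, h3] with z hz1 hz2 hz3
  by_cases hza : z = a
  · rwa [hza]
  · exact IsLocalBranches.of_injective hz1 (hz3 hza) hz2

/-- Two families of branches at the same point agree up to a permutation, as germs. -/
theorem IsLocalBranches.exists_perm (h : IsLocalBranches Φ a f) (h' : IsLocalBranches Φ a f') :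
    ∃ σ : Equiv.Perm (Fin n), ∀ i, f' i =ᶠ[𝓝 a] f (σ i) := by
  have hex : ∀ i, ∃ j, f' i =ᶠ[𝓝 a] f j := by
    intro i
    by_contra hcon
    push Not at hcon
    have h1 : ∀ᶠ z in 𝓝[≠] a, ∀ j, f' i z ≠ f j z := eventually_all.2 fun j =>
      (h'.1 i).eventually_ne_of_not_eventuallyEq (h.1 j) (hcon j)
    obtain ⟨z, h2, h3, h4⟩ := (h1.and (nhdsWithin_le_nhds (h.2.1.and h'.2.1))).exists
    obtain ⟨j, hj⟩ := (h4.symm.trans h3).subset (mem_range_self i)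
    exact h2 j hj.symm
  choose σ hσ using hex
  have hinj : Function.Injective σ := by
    intro i j hij
    by_contra hne
    exact h'.2.2 i j hne ((hσ i).trans (hij ▸ (hσ j).symm))
  exact ⟨Equiv.ofBijective σ (Finite.injective_iff_bijective.1 hinj), hσ⟩

theorem IsLocalBranches.sum_eq (h : IsLocalBranches Φ a f) (h' : IsLocalBranches Φ a f')
    {M : Type*} [AddCommMonoid M] (T : (ℂ → ℂ) → M)
    (hT : ∀ u v : ℂ → ℂ, u =ᶠ[𝓝 a] v → T u = T v) : ∑ i, T (f' i) = ∑ i, T (f i) := by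
  obtain ⟨σ, hσ⟩ := h.exists_perm h'
  rw [← Equiv.sum_comp σ fun i => T (f i)]
  exact Finset.sum_congr rfl fun i _ => hT _ _ (hσ i)

theorem countable_of_eventually_notMem {O T : Set ℂ} (hTO : T ⊆ O)
    (h : ∀ a ∈ O, ∀ᶠ z in 𝓝[≠] a, z ∉ T) : T.Countable := by
  obtain ⟨t, -, ht, hTt⟩ := TopologicalSpace.countable_cover_nhdsWithin (s := T)
    (f := fun x => {x}) (fun x hx => by
      have h1 := eventually_nhdsWithin_iff.1 (h x (hTO hx))
      rw [mem_nhdsWithin_iff_eventually]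
      filter_upwards [h1] with z hz hzT
      by_contra hne
      exact hz hne hzT)
  refine ht.mono fun x hx => ?_
  obtain ⟨y, hy, hxy⟩ := mem_iUnion₂.1 (hTt hx)
  rwa [mem_singleton_iff.1 hxy]

variable {D S : Set ℂ}

theorem HasBranchesOff.countable (h : HasBranchesOff D Φ S n) : S.Countable :=
  countable_of_eventually_notMem h.1 h.2.1

theorem HasBranchesOff.isOpen_diff (hD : IsOpen D) (h : HasBranchesOff D Φ S n) :
    IsOpen (D \ S) := by
  rw [isOpen_iff_mem_nhds]
  intro a ha
  filter_upwards [hD.mem_nhds ha.1, eventually_nhdsWithin_iff.1 (h.2.1 a ha.1)] with z h1 h2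
  refine ⟨h1, ?_⟩
  by_cases hza : z = a
  · rw [hza]; exact ha.2
  · exact h2 hza

end Branches

/-! ### Transferring primitives, and regular points -/

section Transfer

variable {D₁ D₂ S : Set ℂ} {V : Set (ℂ × ℂ)} {n : ℕ}

theorem IsLocalBranches.mem_corrMap {z : ℂ} {f : Fin n → ℂ → ℂ}
    (hf : IsLocalBranches (corrMap V) z f) (i : Fin n) : (z, f i z) ∈ V :=
  hf.2.1.self_of_nhds.superset (mem_range_self i)

/-- If `g` is a primitive of `h` on `D₂`, then the sum of `g` over the branches of a proper
correspondence extends holomorphically to `D₁`, since properness keeps it bounded near the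
exceptional points. Its derivative is the transfer of `h`. -/
theorem exists_differentiableOn_deriv_eq_sum (hD₁ : IsOpen D₁)
    (hV : IsProperHolomorphicCorrespondence D₁ D₂ V) (hS : HasBranchesOff D₁ (corrMap V) S n)
    {g h : ℂ → ℂ} (hg : ∀ w ∈ D₂, HasDerivAt g (h w) w) :
    ∃ G : ℂ → ℂ, DifferentiableOn ℂ G D₁ ∧ ∀ z ∈ D₁ \ S, ∀ f : Fin n → ℂ → ℂ,
      IsLocalBranches (corrMap V) z f → deriv G z = ∑ i, deriv (f i) z * h (f i z) := by
  classical
  have hgd : DifferentiableOn ℂ g D₂ := fun w hw =>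
    (hg w hw).differentiableAt.differentiableWithinAt
  have hch : ∀ z, ∃ f : Fin n → ℂ → ℂ, z ∈ D₁ \ S → IsLocalBranches (corrMap V) z f := by
    intro z
    by_cases hz : z ∈ D₁ \ S
    · obtain ⟨f, hf⟩ := hS.2.2 z hz
      exact ⟨f, fun _ => hf⟩
    · exact ⟨fun _ _ => 0, fun h => absurd h hz⟩
  choose br hbr using hch
  let φ : ℂ → ℂ := fun z => ∑ i, g (br z i z)
  have hopen := hS.isOpen_diff hD₁
  have hφ : ∀ a ∈ D₁ \ S, ∀ f : Fin n → ℂ → ℂ, IsLocalBranches (corrMap V) a f →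
      φ =ᶠ[𝓝 a] fun z => ∑ i, g (f i z) := by
    intro a ha f hf
    filter_upwards [hf.eventually, hopen.mem_nhds ha] with z hz hzD
    exact hz.sum_eq (hbr z hzD) (fun u => g (u z)) fun u v huv => by rw [huv.self_of_nhds]
  have hφd : ∀ a ∈ D₁ \ S, ∀ f : Fin n → ℂ → ℂ, IsLocalBranches (corrMap V) a f →
      HasDerivAt φ (∑ i, deriv (f i) a * h (f i a)) a := by
    intro a ha f hf
    refine HasDerivAt.congr_of_eventuallyEq ?_ (hφ a ha f hf)
    refine HasDerivAt.fun_sum fun i _ => ?_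
    rw [mul_comm]
    exact (hg _ (hV.1.1 (hf.mem_corrMap i)).2).comp a (hf.1 i).differentiableAt.hasDerivAt
  let G : ℂ → ℂ := fun z => if z ∈ S then limUnder (𝓝[≠] z) φ else φ z
  have hGφ : ∀ a ∈ D₁ \ S, G =ᶠ[𝓝 a] φ := by
    intro a ha
    filter_upwards [hopen.mem_nhds ha] with z hz
    exact if_neg hz.2
  refine ⟨G, fun a ha => ?_, fun a ha f hf => ?_⟩
  · refine DifferentiableAt.differentiableWithinAt ?_
    by_cases haS : a ∈ S
    · obtain ⟨ε, hε, hεD⟩ := Metric.nhds_basis_closedBall.mem_iff.1 (hD₁.mem_nhds ha)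
      have hK := (hV.2.1 _ hεD (isCompact_closedBall a ε)).image continuous_snd
      have hKD : Prod.snd '' (V ∩ Prod.fst ⁻¹' Metric.closedBall a ε) ⊆ D₂ := by
        rintro _ ⟨x, hx, rfl⟩
        exact (hV.1.1 hx.1).2
      obtain ⟨M, hM⟩ := hK.exists_bound_of_continuousOn (hgd.continuousOn.mono hKD)
      let s : Set ℂ := Metric.closedBall a ε ∩ {z | z ≠ a → z ∉ S}
      have hs : s ∈ 𝓝 a :=
        inter_mem (Metric.closedBall_mem_nhds a hε) (eventually_nhdsWithin_iff.1 (hS.2.1 a ha))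
      have hsD : s \ {a} ⊆ D₁ \ S := fun z hz => ⟨hεD hz.1.1, hz.1.2 hz.2⟩
      have hd : DifferentiableOn ℂ φ (s \ {a}) := fun z hz =>
        (hφd z (hsD hz) _ (hbr z (hsD hz))).differentiableAt.differentiableWithinAt
      have hb : BddAbove (norm ∘ φ '' (s \ {a})) := by
        refine ⟨n * M, ?_⟩
        rintro _ ⟨z, hz, rfl⟩
        calc ‖φ z‖ ≤ ∑ i, ‖g (br z i z)‖ := norm_sum_le _ _
          _ ≤ ∑ _i : Fin n, M := Finset.sum_le_sum fun i _ =>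
              hM _ ⟨(z, br z i z), ⟨(hbr z (hsD hz)).mem_corrMap i, hz.1.1⟩, rfl⟩
          _ = n * M := by simp
      have hrem := Complex.differentiableOn_update_limUnder_of_bddAbove hs hd hb
      refine (hrem.differentiableAt hs).congr_of_eventuallyEq ?_
      filter_upwards [hs] with z hz
      by_cases hza : z = a
      · subst hza
        rw [Function.update_self]
        exact if_pos haS
      · rw [Function.update_of_ne hza]
        exact if_neg (hz.2 hza)
    · obtain ⟨f, hf⟩ := hS.2.2 a ⟨ha, haS⟩
      exact (hφd a ⟨ha, haS⟩ f hf).differentiableAt.congr_of_eventuallyEq (hGφ a ⟨ha, haS⟩)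
  · rw [(hGφ a ha).deriv_eq, (hφd a ha f hf).deriv]

/-- No branch is locally constant, because the fibres over points of `D₂` are finite. -/
theorem IsLocalBranches.eventually_deriv_ne_zero (hD₁ : IsPlanarDomain D₁)
    (hV : IsProperHolomorphicCorrespondence D₁ D₂ V) {a : ℂ} {f : Fin n → ℂ → ℂ}
    (hf : IsLocalBranches (corrMap V) a f) (i : Fin n) : ∀ᶠ z in 𝓝[≠] a, deriv (f i) z ≠ 0 := by
  rcases (hf.1 i).deriv.eventually_eq_zero_or_eventually_ne_zero with h | h
  swap
  · exact h
  exfalso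
  obtain ⟨ε, hε, hb⟩ := Metric.eventually_nhds_iff_ball.1
    (h.and ((hf.1 i).eventually_analyticAt.and hf.eventually))
  have hconst : ∀ z ∈ Metric.ball a ε, f i z = f i a := fun z hz =>
    Metric.isOpen_ball.is_const_of_deriv_eq_zero (convex_ball a ε).isPreconnected
      (fun x hx => (hb x hx).2.1.differentiableAt.differentiableWithinAt)
      (fun x hx => (hb x hx).1) hz (Metric.mem_ball_self hε)
  refine infinite_of_mem_nhds a (s := corrMap (Prod.swap ⁻¹' V) (f i a)) ?_
    (hV.swap.finite_corrMap hD₁ (hV.1.1 (hf.mem_corrMap i)).2)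
  filter_upwards [Metric.ball_mem_nhds a hε] with z hz
  have := (hb z hz).2.2.mem_corrMap i
  rw [hconst z hz] at this
  exact this

/-- A family of branches at `z` with distinct values and nonzero derivatives. -/
def IsRegularBranches (Φ : ℂ → Set ℂ) (z : ℂ) (f : Fin n → ℂ → ℂ) : Prop :=
  IsLocalBranches Φ z f ∧ (Function.Injective fun i => f i z) ∧ ∀ i, deriv (f i) z ≠ 0

theorem HasBranchesOff.countable_not_regular (hD₁ : IsPlanarDomain D₁)
    (hV : IsProperHolomorphicCorrespondence D₁ D₂ V) (hS : HasBranchesOff D₁ (corrMap V) S n) :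
    {z ∈ D₁ | z ∈ S ∨ ¬ ∃ f : Fin n → ℂ → ℂ, IsRegularBranches (corrMap V) z f}.Countable := by
  have h1 : {z ∈ D₁ \ S | ¬ ∃ f : Fin n → ℂ → ℂ, IsRegularBranches (corrMap V) z f}.Countable := by
    refine countable_of_eventually_notMem (O := D₁ \ S) (fun z hz => hz.1) fun a ha => ?_
    obtain ⟨f, hf⟩ := hS.2.2 a ha
    filter_upwards [nhdsWithin_le_nhds hf.eventually, hf.eventually_injective,
      eventually_all.2 fun i => hf.eventually_deriv_ne_zero hD₁ hV i] with z h1 h2 h3 h4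
    exact h4.2 ⟨f, h1, h2, h3⟩
  refine (hS.countable.union h1).mono fun z hz => ?_
  by_cases hzS : z ∈ S
  · exact Or.inl hzS
  · exact Or.inr ⟨⟨hz.1, hzS⟩, hz.2.resolve_left hzS⟩

theorem HasBranchesOff.ae_regular (hD₁ : IsPlanarDomain D₁)
    (hV : IsProperHolomorphicCorrespondence D₁ D₂ V) (hS : HasBranchesOff D₁ (corrMap V) S n) :
    ∀ᵐ z ∂volume.restrict D₁, z ∈ D₁ \ S ∧
      ∃ f : Fin n → ℂ → ℂ, IsRegularBranches (corrMap V) z f := by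
  have h0 := (hS.countable_not_regular hD₁ hV).ae_notMem (volume.restrict D₁)
  filter_upwards [h0, ae_restrict_mem hD₁.1.measurableSet] with z h1 h2
  by_contra hcon
  refine h1 ⟨h2, ?_⟩
  by_contra hc
  push Not at hc
  exact hcon ⟨⟨h2, hc.1⟩, hc.2⟩

end Transfer

/-! ### Biholomorphic patches and change of variables -/

section Patches

variable {D₁ D₂ S : Set ℂ} {V : Set (ℂ × ℂ)}

/-- A biholomorphic patch of a correspondence: inside `e.source ×ˢ e.target`, the variety `V` is the
graph of the biholomorphic map `e`. -/
structure IsPatch (D₁ D₂ : Set ℂ) (V : Set (ℂ × ℂ)) (e : OpenPartialHomeomorph ℂ ℂ) : Prop where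
  source_subset : e.source ⊆ D₁
  target_subset : e.target ⊆ D₂
  differentiableOn : DifferentiableOn ℂ e e.source
  deriv_ne_zero : ∀ z ∈ e.source, deriv e z ≠ 0
  mem_iff : ∀ z ∈ e.source, ∀ w ∈ e.target, (z, w) ∈ V ↔ e z = w

namespace IsPatch

variable {e : OpenPartialHomeomorph ℂ ℂ}

theorem hasDerivAt (he : IsPatch D₁ D₂ V e) {z : ℂ} (hz : z ∈ e.source) :
    HasDerivAt e (deriv e z) z :=
  (he.differentiableOn.differentiableAt (e.open_source.mem_nhds hz)).hasDerivAt

theorem hasDerivAt_symm (he : IsPatch D₁ D₂ V e) {w : ℂ} (hw : w ∈ e.target) :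
    HasDerivAt e.symm (deriv e (e.symm w))⁻¹ w :=
  e.hasDerivAt_symm hw (he.deriv_ne_zero _ (e.map_target hw)) (he.hasDerivAt (e.map_target hw))

theorem symm (he : IsPatch D₁ D₂ V e) : IsPatch D₂ D₁ (Prod.swap ⁻¹' V) e.symm where
  source_subset := he.target_subset
  target_subset := he.source_subset
  differentiableOn w hw := (he.hasDerivAt_symm hw).differentiableAt.differentiableWithinAt
  deriv_ne_zero w hw := by
    rw [(he.hasDerivAt_symm hw).deriv]
    exact inv_ne_zero (he.deriv_ne_zero _ (e.map_target hw))
  mem_iff w hw z hz := by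
    change (z, w) ∈ V ↔ _
    rw [he.mem_iff z hz w hw]
    exact ⟨fun h => by rw [← h, e.left_inv hz], fun h => by rw [← h, e.right_inv hw]⟩

theorem mem (he : IsPatch D₁ D₂ V e) {z : ℂ} (hz : z ∈ e.source) : (z, e z) ∈ V :=
  (he.mem_iff z hz _ (e.map_source hz)).2 rfl

end IsPatch

theorem isPatch_empty : IsPatch D₁ D₂ V ((OpenPartialHomeomorph.refl ℂ).restrOpen ∅ isOpen_empty) := by
  have hs : ((OpenPartialHomeomorph.refl ℂ).restrOpen ∅ isOpen_empty).source = ∅ := by simp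
  constructor
  · simp
  · simp
  · rw [hs]; exact differentiableOn_empty
  · simp
  · simp

/-- Every point of `V` over a regular point lies on a patch, by the inverse function theorem. -/
theorem IsRegularBranches.exists_patch (hD₁ : IsOpen D₁)
    (hV : IsProperHolomorphicCorrespondence D₁ D₂ V) {n : ℕ} {z : ℂ} {f : Fin n → ℂ → ℂ}
    (hz : z ∈ D₁) (hf : IsRegularBranches (corrMap V) z f) (i : Fin n) :
    ∃ e, IsPatch D₁ D₂ V e ∧ z ∈ e.source ∧ e z = f i z := by
  classical
  have hsd : HasStrictFDerivAt (f i) _ z :=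
    (hf.1.1 i).hasStrictDerivAt.hasStrictFDerivAt_equiv (hf.2.2 i)
  let e₀ := hsd.toOpenPartialHomeomorph (f i)
  have he₀ : z ∈ e₀.source := hsd.mem_toOpenPartialHomeomorph_source
  -- a disc around `f i z` that the other branches avoid near `z`
  have hρ : ∀ᶠ ρ in 𝓝[>] (0 : ℝ), 0 < ρ ∧ ∀ j, j ≠ i → 2 * ρ < dist (f j z) (f i z) := by
    refine eventually_mem_nhdsWithin.and (eventually_all.2 fun j => ?_)
    by_cases hj : j = i
    · simp [hj]
    · have h0 : ContinuousAt (fun ρ : ℝ => 2 * ρ) 0 := by fun_prop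
      filter_upwards [nhdsWithin_le_nhds (h0.eventually_lt continuousAt_const
        (by rw [mul_zero]; exact dist_pos.2 fun he => hj (hf.2.1 he) :
          2 * (0 : ℝ) < dist (f j z) (f i z)))] with ρ hρ _ using hρ
  obtain ⟨ρ, hρ0, hρ⟩ := hρ.exists
  have hev : ∀ᶠ x in 𝓝 z, x ∈ D₁ ∧ AnalyticAt ℂ (f i) x ∧ deriv (f i) x ≠ 0 ∧
      (corrMap V x = range fun j => f j x) ∧ ∀ j, f j x ∈ Metric.ball (f j z) ρ := by
    have h0 : ∀ᶠ x in 𝓝 z, x ∈ D₁ := hD₁.mem_nhds hz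
    refine h0.and ((hf.1.1 i).eventually_analyticAt.and
      (((hf.1.1 i).deriv.continuousAt.eventually_ne (hf.2.2 i)).and (hf.1.2.1.and
      (eventually_all.2 fun j => ?_))))
    exact (hf.1.1 j).continuousAt (Metric.ball_mem_nhds _ hρ0)
  obtain ⟨U, hU, hUo, hzU⟩ := eventually_nhds_iff.1 hev
  have hsrc : (e₀.restrOpen U hUo).source = e₀.source ∩ U := e₀.restrOpen_source U hUo
  have hcoe : ∀ x, e₀.restrOpen U hUo x = f i x := fun x => rfl
  have hcoe' : (e₀.restrOpen U hUo : ℂ → ℂ) = f i := rfl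
  have htgt : ∀ w ∈ (e₀.restrOpen U hUo).target, w ∈ Metric.ball (f i z) ρ ∧ w ∈ D₂ := by
    intro w hw
    rw [← OpenPartialHomeomorph.image_source_eq_target] at hw
    obtain ⟨x, hx, rfl⟩ := hw
    rw [hsrc] at hx
    have h1 := hU x hx.2
    refine ⟨h1.2.2.2.2 i, hV.corrMap_subset x ?_⟩
    rw [h1.2.2.2.1]
    exact mem_range_self i
  refine ⟨e₀.restrOpen U hUo, ⟨?_, fun w hw => (htgt w hw).2, ?_, ?_, ?_⟩, ?_, rfl⟩
  · rw [hsrc]; exact fun x hx => (hU x hx.2).1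
  · rw [hsrc, hcoe']
    exact fun x hx => (hU x hx.2).2.1.differentiableAt.differentiableWithinAt
  · rw [hsrc, hcoe']; exact fun x hx => (hU x hx.2).2.2.1
  · intro x hx w hw
    rw [hsrc] at hx
    have h1 := hU x hx.2
    rw [hcoe]
    constructor
    · intro hxw
      obtain ⟨j, hj⟩ := h1.2.2.2.1.subset (show w ∈ corrMap V x from hxw)
      dsimp only at hj
      by_cases hji : j = i
      · rw [← hj, hji]
      · exfalso
        have h2 := h1.2.2.2.2 j
        have h3 := (htgt w hw).1
        rw [hj] at h2
        have h4 := hρ j hji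
        rw [Metric.mem_ball] at h2 h3
        have h5 := dist_triangle_left (f j z) (f i z) w
        linarith
    · intro hw'
      exact h1.2.2.2.1.superset ⟨i, hw'⟩
  · rw [hsrc]; exact ⟨he₀, hzU⟩

/-- A sequence of patches that together cover all points of `V` covered by some patch. -/
structure IsPatchSequence (D₁ D₂ : Set ℂ) (V : Set (ℂ × ℂ))
    (e : ℕ → OpenPartialHomeomorph ℂ ℂ) : Prop where
  isPatch : ∀ n, IsPatch D₁ D₂ V (e n)
  exists_mem : ∀ e', IsPatch D₁ D₂ V e' → ∀ z ∈ e'.source, ∃ n,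
    z ∈ (e n).source ∧ e' z ∈ (e n).target

theorem exists_isPatchSequence (D₁ D₂ : Set ℂ) (V : Set (ℂ × ℂ)) :
    ∃ e, IsPatchSequence D₁ D₂ V e := by
  let ι := {e : OpenPartialHomeomorph ℂ ℂ // IsPatch D₁ D₂ V e}
  let s : ι → Set (ℂ × ℂ) := fun e => e.1.source ×ˢ e.1.target
  obtain ⟨T, hT, hTs⟩ := TopologicalSpace.isOpen_iUnion_countable s fun e =>
    e.1.open_source.prod e.1.open_target
  -- the empty patch makes the countable family nonempty, so that a sequence can enumerate it
  obtain ⟨e, he⟩ := (hT.insert (⟨_, isPatch_empty⟩ : ι)).exists_eq_range (insert_nonempty _ _)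
  refine ⟨fun n => (e n).1, fun n => (e n).2, fun e' he' z hz => ?_⟩
  have h1 : (z, e' z) ∈ ⋃ i, s i := mem_iUnion.2 ⟨⟨e', he'⟩, hz, e'.map_source hz⟩
  rw [← hTs] at h1
  obtain ⟨i, hi, hzi⟩ := mem_iUnion₂.1 h1
  have h2 : i ∈ range e := he ▸ mem_insert_of_mem _ hi
  obtain ⟨n, rfl⟩ := h2
  exact ⟨n, hzi⟩

theorem IsPatchSequence.symm {e : ℕ → OpenPartialHomeomorph ℂ ℂ}
    (he : IsPatchSequence D₁ D₂ V e) :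
    IsPatchSequence D₂ D₁ (Prod.swap ⁻¹' V) fun n => (e n).symm where
  isPatch n := (he.isPatch n).symm
  exists_mem e' he' w hw := by
    obtain ⟨n, h1, h2⟩ := he.exists_mem e'.symm he'.symm (e' w) (e'.map_source hw)
    rw [e'.left_inv hw] at h2
    exact ⟨n, h2, h1⟩

/-- The points of the domain of the `n`-th patch whose lift to `V` lies on no earlier patch. -/
def patchPiece (e : ℕ → OpenPartialHomeomorph ℂ ℂ) (n : ℕ) : Set ℂ :=
  {z ∈ (e n).source | ∀ m < n, ¬ (z ∈ (e m).source ∧ e n z ∈ (e m).target)}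

theorem measurableSet_patchPiece (e : ℕ → OpenPartialHomeomorph ℂ ℂ) (n : ℕ) :
    MeasurableSet (patchPiece e n) := by
  have h : patchPiece e n = (e n).source \ ⋃ m ∈ {m | m < n},
      (e m).source ∩ ((e n).source ∩ e n ⁻¹' (e m).target) := by
    ext z
    simp only [patchPiece, mem_ofPred_eq, Set.mem_sdiff, mem_iUnion, mem_inter_iff, mem_preimage,
      not_exists, not_and]
    constructor
    · rintro ⟨h1, h2⟩
      exact ⟨h1, fun m hm h3 _ h4 => h2 m hm h3 h4⟩
    · rintro ⟨h1, h2⟩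
      exact ⟨h1, fun m hm h3 h4 => h2 m hm h3 h1 h4⟩
  rw [h]
  refine (e n).open_source.measurableSet.diff (MeasurableSet.biUnion (to_countable _) fun m _ => ?_)
  exact ((e m).open_source.inter ((e n).isOpen_inter_preimage (e m).open_target)).measurableSet

theorem patchPiece_subset (e : ℕ → OpenPartialHomeomorph ℂ ℂ) (n : ℕ) :
    patchPiece e n ⊆ (e n).source := fun _ hz => hz.1

/-- The pieces are the projections to `D₁` of a partition of the part of `V` on patches, so the pieces
of the inverse patches, which are the projections to `D₂`, are their images. -/
theorem image_patchPiece (e : ℕ → OpenPartialHomeomorph ℂ ℂ) (n : ℕ) :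
    e n '' patchPiece e n = patchPiece (fun n => (e n).symm) n := by
  ext w
  constructor
  · rintro ⟨z, hz, rfl⟩
    refine ⟨(e n).map_source hz.1, fun m hm h => hz.2 m hm ?_⟩
    change e n z ∈ (e m).target ∧ (e n).symm (e n z) ∈ (e m).source at h
    rw [(e n).left_inv hz.1] at h
    exact ⟨h.2, h.1⟩
  · rintro ⟨hw, hw'⟩
    change w ∈ (e n).target at hw
    refine ⟨(e n).symm w, ⟨(e n).map_target hw, fun m hm h => hw' m hm ?_⟩, (e n).right_inv hw⟩
    rw [(e n).right_inv hw] at h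
    exact ⟨h.2, h.1⟩

/-- Over a regular point, the pieces correspond bijectively to the branches. -/
theorem IsPatchSequence.exists_index {e : ℕ → OpenPartialHomeomorph ℂ ℂ}
    (he : IsPatchSequence D₁ D₂ V e) (hD₁ : IsOpen D₁)
    (hV : IsProperHolomorphicCorrespondence D₁ D₂ V) {p : ℕ} {z : ℂ} {f : Fin p → ℂ → ℂ}
    (hz : z ∈ D₁) (hf : IsRegularBranches (corrMap V) z f) :
    ∃ ν : Fin p → ℕ, Function.Injective ν ∧ (∀ i, z ∈ patchPiece e (ν i)) ∧
      (∀ i, e (ν i) =ᶠ[𝓝 z] f i) ∧ ∀ n, z ∈ patchPiece e n → n ∈ range ν := by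
  classical
  have hex : ∀ i, ∃ n, z ∈ (e n).source ∧ f i z ∈ (e n).target := by
    intro i
    obtain ⟨e', he', h1, h2⟩ := hf.exists_patch hD₁ hV hz i
    rw [← h2]
    exact he.exists_mem e' he' z h1
  let ν : Fin p → ℕ := fun i => Nat.find (hex i)
  have hν : ∀ i, z ∈ (e (ν i)).source ∧ f i z ∈ (e (ν i)).target := fun i => Nat.find_spec (hex i)
  have hνz : ∀ i, e (ν i) z = f i z := fun i =>
    ((he.isPatch (ν i)).mem_iff z (hν i).1 _ (hν i).2).1 (hf.1.mem_corrMap i)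
  have hpiece : ∀ i, z ∈ patchPiece e (ν i) := fun i =>
    ⟨(hν i).1, fun m hm h => Nat.find_min (hex i) hm (by rwa [hνz i] at h)⟩
  refine ⟨ν, fun i j hij => ?_, hpiece, fun i => ?_, fun n hn => ?_⟩
  · have := hνz i
    rw [hij, hνz j] at this
    exact (hf.2.1 this).symm
  · have hc := (hf.1.1 i).continuousAt
    filter_upwards [(e (ν i)).open_source.mem_nhds (hν i).1,
      hc.preimage_mem_nhds ((e (ν i)).open_target.mem_nhds (hν i).2), hf.1.2.1] with x h1 h2 h3
    exact ((he.isPatch (ν i)).mem_iff x h1 _ h2).1 (h3.superset (mem_range_self i))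
  · obtain ⟨i, hi⟩ := hf.1.2.1.self_of_nhds.subset
      (show e n z ∈ corrMap V z from (he.isPatch n).mem hn.1)
    dsimp only at hi
    refine ⟨i, le_antisymm ?_ ?_⟩
    · exact Nat.find_min' (hex i) ⟨hn.1, hi ▸ (e n).map_source hn.1⟩
    · by_contra hlt
      push Not at hlt
      exact hn.2 (ν i) hlt ⟨(hν i).1, hi ▸ (hν i).2⟩

theorem det_restrictScalars_smulRight (c : ℂ) :
    ((ContinuousLinearMap.toSpanSingleton ℂ c).restrictScalars ℝ : ℂ →L[ℝ] ℂ).det = ‖c‖ ^ 2 := by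
  simp [ContinuousLinearMap.det, LinearMap.det_restrictScalars, Algebra.norm_complex_eq,
    Complex.normSq_eq_norm_sq]

theorem IsPatch.lintegral_image {e : OpenPartialHomeomorph ℂ ℂ} (he : IsPatch D₁ D₂ V e)
    {A : Set ℂ} (hA : MeasurableSet A) (hAe : A ⊆ e.source) (g : ℂ → ENNReal) :
    ∫⁻ w in e '' A, g w = ∫⁻ z in A, ‖deriv e z‖ₑ ^ 2 * g (e z) := by
  rw [lintegral_image_eq_lintegral_abs_det_fderiv_mul volume hA
    (fun z hz => ((he.hasDerivAt (hAe hz)).hasFDerivAt.restrictScalars ℝ).hasFDerivWithinAt)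
    (e.injOn.mono hAe)]
  refine lintegral_congr fun z => ?_
  rw [det_restrictScalars_smulRight, abs_of_nonneg (by positivity),
    ENNReal.ofReal_pow (norm_nonneg _), ofReal_norm]

theorem IsPatch.integral_image {e : OpenPartialHomeomorph ℂ ℂ} (he : IsPatch D₁ D₂ V e)
    {A : Set ℂ} (hA : MeasurableSet A) (hAe : A ⊆ e.source) (g : ℂ → ℂ) :
    ∫ w in e '' A, g w = ∫ z in A, (deriv e z * conj (deriv e z)) * g (e z) := by
  rw [integral_image_eq_integral_abs_det_fderiv_smul volume hA
    (fun z hz => ((he.hasDerivAt (hAe hz)).hasFDerivAt.restrictScalars ℝ).hasFDerivWithinAt)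
    (e.injOn.mono hAe)]
  refine integral_congr_ae (Eventually.of_forall fun z => ?_)
  simp only
  rw [det_restrictScalars_smulRight, abs_of_nonneg (by positivity), Complex.mul_conj,
    Complex.normSq_eq_norm_sq, Complex.real_smul]

end Patches

/-! ### The transfer operators and their adjointness -/

section Adjoint

variable {D₁ D₂ S S' : Set ℂ} {V : Set (ℂ × ℂ)} {p q : ℕ} {e : ℕ → OpenPartialHomeomorph ℂ ℂ}
  {h k u l : ℂ → ℂ}

/-- On `D \ S`, the function `k` is the transfer `∑ i, f i' · (h ∘ f i)` of `h` under the branches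
`f i` of `Φ`. -/
def IsTransfer (Φ : ℂ → Set ℂ) (D S : Set ℂ) (n : ℕ) (h k : ℂ → ℂ) : Prop :=
  ∀ z ∈ D \ S, ∀ f : Fin n → ℂ → ℂ, IsLocalBranches Φ z f →
    k z = ∑ i, deriv (f i) z * h (f i z)

theorem tsum_indicator_eq_sum {α M : Type*} [AddCommMonoid M] [TopologicalSpace M]
    {A : ℕ → Set α} {z : α} {ν : Fin p → ℕ} (hν : Function.Injective ν) (hA : ∀ i, z ∈ A (ν i))
    (hA' : ∀ n, z ∈ A n → n ∈ range ν) (c : ℕ → α → M) :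
    ∑' n, (A n).indicator (c n) z = ∑ i, c (ν i) z := by
  have hsupp : (Function.support fun n => (A n).indicator (c n) z) ⊆ range ν := fun n hn =>
    hA' n (mem_of_indicator_ne_zero hn)
  rw [← hν.tsum_eq hsupp, tsum_fintype]
  exact Finset.sum_congr rfl fun i _ => indicator_of_mem (hA i) _

theorem IsPatchSequence.piece_subset (he : IsPatchSequence D₁ D₂ V e) (n : ℕ) :
    patchPiece e n ⊆ D₁ :=
  (patchPiece_subset e n).trans (he.isPatch n).source_subset

theorem IsPatchSequence.restrict_piece (he : IsPatchSequence D₁ D₂ V e) (n : ℕ) :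
    (volume.restrict D₁).restrict (patchPiece e n) = volume.restrict (patchPiece e n) := by
  rw [Measure.restrict_restrict (measurableSet_patchPiece e n),
    inter_eq_self_of_subset_left (he.piece_subset n)]

/-- Almost every point of `D₁` lies in exactly `p` of the pieces. -/
theorem IsPatchSequence.tsum_lintegral_piece (he : IsPatchSequence D₁ D₂ V e)
    (hD₁ : IsPlanarDomain D₁) (hV : IsProperHolomorphicCorrespondence D₁ D₂ V)
    (hS : HasBranchesOff D₁ (corrMap V) S p) {φ : ℂ → ENNReal}
    (hφ : AEMeasurable φ (volume.restrict D₁)) :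
    ∑' n, ∫⁻ z in patchPiece e n, φ z = p * ∫⁻ z in D₁, φ z := by
  have h1 : ∀ n, ∫⁻ z in patchPiece e n, φ z =
      ∫⁻ z in D₁, (patchPiece e n).indicator φ z := fun n => by
    rw [lintegral_indicator (measurableSet_patchPiece e n), he.restrict_piece]
  simp only [h1]
  rw [← lintegral_tsum fun n => hφ.indicator (measurableSet_patchPiece e n),
    ← lintegral_const_mul' _ _ (ENNReal.natCast_ne_top p)]
  refine lintegral_congr_ae ?_
  filter_upwards [hS.ae_regular hD₁ hV] with z hz
  obtain ⟨f, hf⟩ := hz.2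
  obtain ⟨ν, hν, hA, -, hA'⟩ := he.exists_index hD₁.1 hV hz.1.1 hf
  rw [tsum_indicator_eq_sum hν hA hA' fun _ => φ]
  simp

theorem IsPatchSequence.continuousOn_mul_comp (he : IsPatchSequence D₁ D₂ V e)
    (hh : DifferentiableOn ℂ h D₂) (n : ℕ) :
    ContinuousOn (fun z => deriv (e n) z * h (e n z)) (e n).source := by
  have h1 := (he.isPatch n).differentiableOn
  refine (h1.deriv (e n).open_source).continuousOn.mul (hh.continuousOn.comp h1.continuousOn ?_)
  exact fun z hz => (he.isPatch n).target_subset ((e n).map_source hz)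

theorem IsPatchSequence.aestronglyMeasurable (he : IsPatchSequence D₁ D₂ V e)
    (hh : DifferentiableOn ℂ h D₂) (n : ℕ) :
    AEStronglyMeasurable (fun z => deriv (e n) z * h (e n z))
      (volume.restrict (patchPiece e n)) :=
  ((he.continuousOn_mul_comp hh n).aestronglyMeasurable
    (e n).open_source.measurableSet).mono_set (patchPiece_subset e n)

theorem IsPatchSequence.lintegral_enorm_sq (he : IsPatchSequence D₁ D₂ V e) (n : ℕ) :
    ∫⁻ z in patchPiece e n, ‖deriv (e n) z * h (e n z)‖ₑ ^ 2 =
      ∫⁻ w in patchPiece (fun n => (e n).symm) n, ‖h w‖ₑ ^ 2 := by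
  rw [← image_patchPiece, (he.isPatch n).lintegral_image (measurableSet_patchPiece e n)
    (patchPiece_subset e n)]
  simp only [enorm_mul, mul_pow]

theorem DifferentiableOn.aemeasurable_enorm_sq {D : Set ℂ} (hD : IsOpen D)
    (hh : DifferentiableOn ℂ h D) : AEMeasurable (fun z => ‖h z‖ₑ ^ 2) (volume.restrict D) :=
  (hh.continuousOn.aestronglyMeasurable hD.measurableSet).enorm.pow_const 2

theorem IsPatchSequence.tsum_lintegral_enorm_sq (he : IsPatchSequence D₁ D₂ V e)
    (hD₂ : IsPlanarDomain D₂) (hV : IsProperHolomorphicCorrespondence D₁ D₂ V)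
    (hS' : HasBranchesOff D₂ (corrInv V) S' q) (hh : DifferentiableOn ℂ h D₂) :
    ∑' n, ∫⁻ z in patchPiece e n, ‖deriv (e n) z * h (e n z)‖ₑ ^ 2 =
      q * ∫⁻ w in D₂, ‖h w‖ₑ ^ 2 := by
  simp only [he.lintegral_enorm_sq]
  exact he.symm.tsum_lintegral_piece hD₂ hV.swap hS' (hh.aemeasurable_enorm_sq hD₂.1)

/-- At almost every point, the transfer is the sum over the `p` patches on whose pieces the point
lies. -/
theorem IsTransfer.ae_exists_index (hk : IsTransfer (corrMap V) D₁ S p h k)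
    (he : IsPatchSequence D₁ D₂ V e) (hD₁ : IsPlanarDomain D₁)
    (hV : IsProperHolomorphicCorrespondence D₁ D₂ V) (hS : HasBranchesOff D₁ (corrMap V) S p) :
    ∀ᵐ z ∂volume.restrict D₁, ∃ ν : Fin p → ℕ, Function.Injective ν ∧
      (∀ i, z ∈ patchPiece e (ν i)) ∧ (∀ n, z ∈ patchPiece e n → n ∈ range ν) ∧
      k z = ∑ i, deriv (e (ν i)) z * h (e (ν i) z) := by
  filter_upwards [hS.ae_regular hD₁ hV] with z hz
  obtain ⟨f, hf⟩ := hz.2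
  obtain ⟨ν, hν, hA, heq, hA'⟩ := he.exists_index hD₁.1 hV hz.1.1 hf
  refine ⟨ν, hν, hA, hA', ?_⟩
  rw [hk z hz.1 f hf.1]
  refine Finset.sum_congr rfl fun i _ => ?_
  rw [(heq i).deriv_eq, (heq i).self_of_nhds]

theorem enorm_sum_sq_le (c : Fin p → ℂ) : ‖∑ i, c i‖ₑ ^ 2 ≤ p * ∑ i, ‖c i‖ₑ ^ 2 := by
  have h1 : ‖∑ i, c i‖₊ ^ 2 ≤ p * ∑ i, ‖c i‖₊ ^ 2 := by
    calc ‖∑ i, c i‖₊ ^ 2 ≤ (∑ i, ‖c i‖₊) ^ 2 := by gcongr; exact nnnorm_sum_le _ _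
      _ ≤ p * ∑ i, ‖c i‖₊ ^ 2 := by
        simpa using sq_sum_le_card_mul_sum_sq (s := Finset.univ) (f := fun i => ‖c i‖₊)
  simp only [enorm_eq_nnnorm]
  exact_mod_cast h1

/-- The transfer operator is bounded for the `L²` norms. -/
theorem IsTransfer.lintegral_enorm_sq_le (hk : IsTransfer (corrMap V) D₁ S p h k)
    (hD₁ : IsPlanarDomain D₁) (hD₂ : IsPlanarDomain D₂)
    (hV : IsProperHolomorphicCorrespondence D₁ D₂ V) (hS : HasBranchesOff D₁ (corrMap V) S p)
    (hS' : HasBranchesOff D₂ (corrInv V) S' q) (hh : DifferentiableOn ℂ h D₂) :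
    ∫⁻ z in D₁, ‖k z‖ₑ ^ 2 ≤ p * (q * ∫⁻ w in D₂, ‖h w‖ₑ ^ 2) := by
  obtain ⟨e, he⟩ := exists_isPatchSequence D₁ D₂ V
  rw [← he.tsum_lintegral_enorm_sq hD₂ hV hS' hh]
  have hm : ∀ n, AEMeasurable ((patchPiece e n).indicator
      fun z => ‖deriv (e n) z * h (e n z)‖ₑ ^ 2) (volume.restrict D₁) := fun n => by
    rw [aemeasurable_indicator_iff (measurableSet_patchPiece e n), he.restrict_piece]
    exact (he.aestronglyMeasurable hh n).enorm.pow_const 2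
  have h1 : ∀ n, ∫⁻ z in patchPiece e n, ‖deriv (e n) z * h (e n z)‖ₑ ^ 2 =
      ∫⁻ z in D₁, (patchPiece e n).indicator
        (fun z => ‖deriv (e n) z * h (e n z)‖ₑ ^ 2) z := fun n => by
    rw [lintegral_indicator (measurableSet_patchPiece e n), he.restrict_piece]
  simp only [h1]
  rw [← lintegral_tsum hm, ← lintegral_const_mul' _ _ (ENNReal.natCast_ne_top p)]
  refine lintegral_mono_ae ?_
  filter_upwards [hk.ae_exists_index he hD₁ hV hS] with z hz
  obtain ⟨ν, hν, hA, hA', hkz⟩ := hz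
  rw [tsum_indicator_eq_sum hν hA hA' fun n z => ‖deriv (e n) z * h (e n z)‖ₑ ^ 2, hkz]
  exact enorm_sum_sq_le _

/-- The inner product with a transferred function is a sum of integrals over the pieces. The sum
converges absolutely because both functions are square integrable. -/
theorem IsTransfer.integral_mul_conj (hk : IsTransfer (corrMap V) D₁ S p h k)
    (he : IsPatchSequence D₁ D₂ V e) (hD₁ : IsPlanarDomain D₁) (hD₂ : IsPlanarDomain D₂)
    (hV : IsProperHolomorphicCorrespondence D₁ D₂ V) (hS : HasBranchesOff D₁ (corrMap V) S p)
    (hS' : HasBranchesOff D₂ (corrInv V) S' q) (hh : DifferentiableOn ℂ h D₂)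
    (hu : DifferentiableOn ℂ u D₁) (hh2 : ∫⁻ w in D₂, ‖h w‖ₑ ^ 2 ≠ ⊤)
    (hu2 : ∫⁻ z in D₁, ‖u z‖ₑ ^ 2 ≠ ⊤) :
    ∫ z in D₁, k z * conj (u z) =
      ∑' n, ∫ z in patchPiece e n, deriv (e n) z * h (e n z) * conj (u z) := by
  have h1 : ∀ n, ∫ z in patchPiece e n, deriv (e n) z * h (e n z) * conj (u z) =
      ∫ z in D₁, (patchPiece e n).indicator
        (fun z => deriv (e n) z * h (e n z) * conj (u z)) z := fun n => by
    rw [integral_indicator (measurableSet_patchPiece e n), he.restrict_piece]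
  have hum := hu.continuousOn.aestronglyMeasurable (μ := volume) hD₁.1.measurableSet
  have hm : ∀ n, AEStronglyMeasurable (fun z => deriv (e n) z * h (e n z) * conj (u z))
      (volume.restrict (patchPiece e n)) := fun n =>
    (he.aestronglyMeasurable hh n).mul
      (Complex.continuous_conj.comp_aestronglyMeasurable (hum.mono_set (he.piece_subset n)))
  simp only [h1]
  rw [← integral_tsum]
  · refine integral_congr_ae ?_
    filter_upwards [hk.ae_exists_index he hD₁ hV hS] with z hz
    obtain ⟨ν, hν, hA, hA', hkz⟩ := hz
    rw [tsum_indicator_eq_sum hν hA hA' fun n z => deriv (e n) z * h (e n z) * conj (u z), hkz,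
      Finset.sum_mul]
  · intro n
    rw [aestronglyMeasurable_indicator_iff (measurableSet_patchPiece e n), he.restrict_piece]
    exact hm n
  · -- `|a b| ≤ |a|² + |b|²`, and both sums of integrals are finite
    have hle : ∀ n, ∫⁻ z in D₁, ‖(patchPiece e n).indicator
        (fun z => deriv (e n) z * h (e n z) * conj (u z)) z‖ₑ ≤
        (∫⁻ z in patchPiece e n, ‖deriv (e n) z * h (e n z)‖ₑ ^ 2) +
          ∫⁻ z in patchPiece e n, ‖u z‖ₑ ^ 2 := by
      intro n
      simp only [enorm_indicator_eq_indicator_enorm]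
      rw [lintegral_indicator (measurableSet_patchPiece e n), he.restrict_piece,
        ← lintegral_add_left' ((he.aestronglyMeasurable hh n).enorm.pow_const 2)]
      refine lintegral_mono fun z => ?_
      rw [enorm_mul, RCLike.enorm_conj]
      rcases le_total ‖deriv (e n) z * h (e n z)‖ₑ ‖u z‖ₑ with hle | hle
      · calc _ ≤ ‖u z‖ₑ * ‖u z‖ₑ := by gcongr
          _ ≤ _ := by rw [← sq]; exact le_add_self
      · calc _ ≤ ‖deriv (e n) z * h (e n z)‖ₑ * ‖deriv (e n) z * h (e n z)‖ₑ := by gcongr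
          _ ≤ _ := by rw [← sq]; exact le_self_add
    refine ne_top_of_le_ne_top ?_ (ENNReal.tsum_le_tsum hle)
    rw [ENNReal.tsum_add, he.tsum_lintegral_enorm_sq hD₂ hV hS' hh,
      he.tsum_lintegral_piece hD₁ hV hS (hu.aemeasurable_enorm_sq hD₁.1)]
    exact ENNReal.add_ne_top.2 ⟨ENNReal.mul_ne_top (ENNReal.natCast_ne_top q) hh2,
      ENNReal.mul_ne_top (ENNReal.natCast_ne_top p) hu2⟩

/-- The transfer operators of a correspondence and of its inverse are adjoint to each other: on
each patch, this is the change of variables `w = e z`. -/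
theorem IsTransfer.integral_mul_conj_eq (hk : IsTransfer (corrMap V) D₁ S p h k)
    (hl : IsTransfer (corrInv V) D₂ S' q u l) (hD₁ : IsPlanarDomain D₁)
    (hD₂ : IsPlanarDomain D₂) (hV : IsProperHolomorphicCorrespondence D₁ D₂ V)
    (hS : HasBranchesOff D₁ (corrMap V) S p) (hS' : HasBranchesOff D₂ (corrInv V) S' q)
    (hh : DifferentiableOn ℂ h D₂) (hu : DifferentiableOn ℂ u D₁)
    (hh2 : ∫⁻ w in D₂, ‖h w‖ₑ ^ 2 ≠ ⊤) (hu2 : ∫⁻ z in D₁, ‖u z‖ₑ ^ 2 ≠ ⊤) :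
    ∫ z in D₁, k z * conj (u z) = conj (∫ w in D₂, l w * conj (h w)) := by
  obtain ⟨e, he⟩ := exists_isPatchSequence D₁ D₂ V
  rw [hk.integral_mul_conj he hD₁ hD₂ hV hS hS' hh hu hh2 hu2,
    IsTransfer.integral_mul_conj (V := Prod.swap ⁻¹' V) hl he.symm hD₂ hD₁ hV.swap hS' hS hu hh
      hu2 hh2, Complex.conj_tsum]
  refine tsum_congr fun n => ?_
  rw [← image_patchPiece, (he.isPatch n).integral_image (measurableSet_patchPiece e n)
    (patchPiece_subset e n), ← integral_conj]
  refine setIntegral_congr_fun (measurableSet_patchPiece e n) fun z hz => ?_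
  have hz' := patchPiece_subset e n hz
  have hd := (he.isPatch n).hasDerivAt_symm ((e n).map_source hz')
  rw [(e n).left_inv hz'] at hd
  have h0 : deriv (e n) z ≠ 0 := (he.isPatch n).deriv_ne_zero z hz'
  have h0' : conj (deriv (e n) z) ≠ 0 := (map_ne_zero _).2 h0
  simp only [hd.deriv, (e n).left_inv hz', map_mul, map_inv₀, Complex.conj_conj]
  field_simp

end Adjoint

/-! ### The transformation formula -/

section Formula

variable {D₁ D₂ S S' : Set ℂ} {V : Set (ℂ × ℂ)} {p q : ℕ}

theorem lintegral_enorm_sq_ne_top {D : Set ℂ} {h : ℂ → ℂ} (hh : h ∈ reducedBergmanSpace D) :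
    ∫⁻ z in D, ‖h z‖ₑ ^ 2 ≠ ⊤ := by
  have h1 := hh.2.2.hasFiniteIntegral
  rw [hasFiniteIntegral_iff_enorm] at h1
  simp only [enorm_pow, enorm_norm] at h1
  exact h1.ne

/-- The transfer operator maps the reduced Bergman space of `D₂` to that of `D₁`. -/
theorem exists_isTransfer_mem (hD₁ : IsPlanarDomain D₁) (hD₂ : IsPlanarDomain D₂)
    (hV : IsProperHolomorphicCorrespondence D₁ D₂ V) (hS : HasBranchesOff D₁ (corrMap V) S p)
    (hS' : HasBranchesOff D₂ (corrInv V) S' q) {h : ℂ → ℂ} (hh : h ∈ reducedBergmanSpace D₂) :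
    ∃ k ∈ reducedBergmanSpace D₁, IsTransfer (corrMap V) D₁ S p h k := by
  obtain ⟨g, -, hg⟩ := hh.2.1
  obtain ⟨G, hG, hGk⟩ := exists_differentiableOn_deriv_eq_sum hD₁.1 hV hS hg
  have hk : IsTransfer (corrMap V) D₁ S p h (deriv G) := hGk
  have hd : DifferentiableOn ℂ (deriv G) D₁ := hG.deriv hD₁.1
  refine ⟨deriv G, mem_reducedBergmanSpace_of_memLp hD₁.1 hd
    ⟨G, hG, fun z hz => (hG.differentiableAt (hD₁.1.mem_nhds hz)).hasDerivAt⟩ ?_, hk⟩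
  rw [memLp_two_iff_integrable_sq_norm (DifferentiableOn.aestronglyMeasurable_restrict hD₁.1 hd)]
  refine ⟨(DifferentiableOn.aestronglyMeasurable_restrict hD₁.1 hd).norm.pow 2, ?_⟩
  rw [hasFiniteIntegral_iff_enorm]
  simp only [enorm_pow, enorm_norm]
  refine lt_of_le_of_lt (hk.lintegral_enorm_sq_le hD₁ hD₂ hV hS hS' hh.1) ?_
  exact ENNReal.mul_lt_top (ENNReal.natCast_lt_top p) (ENNReal.mul_lt_top
    (ENNReal.natCast_lt_top q) (lintegral_enorm_sq_ne_top hh).lt_top)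

/-- A correspondence without branches is discrete: its points lie over isolated points, and the
fibres are finite. -/
theorem HasBranchesOff.discreteTopology (hD₂ : IsPlanarDomain D₂)
    (hV : IsProperHolomorphicCorrespondence D₁ D₂ V) (hS : HasBranchesOff D₁ (corrMap V) S 0) :
    DiscreteTopology V := by
  have hemp : ∀ z ∈ D₁ \ S, corrMap V z = ∅ := by
    intro z hz
    obtain ⟨f, hf⟩ := hS.2.2 z hz
    rw [hf.2.1.self_of_nhds]
    exact range_eq_empty _
  rw [discreteTopology_subtype_iff]
  rintro ⟨a, b⟩ hab
  have ha := (hV.1.1 hab).1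
  have h0 : ∀ᶠ z in 𝓝 a, z ≠ a → z ∉ S := eventually_nhdsWithin_iff.1 (hS.2.1 a ha)
  have h1 : ∀ᶠ x : ℂ × ℂ in 𝓝 (a, b), x.1 ≠ a → x.1 ∉ S :=
    (continuous_fst.tendsto (a, b)).eventually h0
  have hfin := (hV.finite_corrMap hD₂ ha).subset (sdiff_subset (s := corrMap V a) (t := {b}))
  have h2 : ∀ᶠ x : ℂ × ℂ in 𝓝 (a, b), x.2 ∉ corrMap V a \ {b} :=
    (continuous_snd.tendsto (a, b)).eventually
      (hfin.isClosed.isOpen_compl.mem_nhds (x := b) fun h => h.2 rfl)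
  rw [← _root_.disjoint_iff, Filter.disjoint_principal_right]
  filter_upwards [nhdsWithin_le_nhds h1, nhdsWithin_le_nhds h2, self_mem_nhdsWithin]
    with x hx1 hx2 hne hxV
  have hxa : x.1 = a := by
    by_contra hxa
    have h3 : x.2 ∈ corrMap V x.1 := hxV
    rw [hemp x.1 ⟨(hV.1.1 hxV).1, hx1 hxa⟩] at h3
    exact h3
  have hxb : x.2 = b := by
    by_contra hxb
    refine hx2 ⟨?_, hxb⟩
    rw [← hxa]
    exact hxV
  exact hne (Prod.ext hxa hxb)

theorem HasBranchesOff.pos_of_not_discreteTopology (hD₂ : IsPlanarDomain D₂)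
    (hV : IsProperHolomorphicCorrespondence D₁ D₂ V) (hS : HasBranchesOff D₁ (corrMap V) S p)
    (h : ¬ DiscreteTopology V) : 0 < p := by
  rw [Nat.pos_iff_ne_zero]
  rintro rfl
  exact h (hS.discreteTopology hD₂ hV)

theorem discreteTopology_of_preimage_swap (h : DiscreteTopology (Prod.swap ⁻¹' V)) :
    DiscreteTopology V := by
  let s : V → (Prod.swap ⁻¹' V : Set (ℂ × ℂ)) := fun x => ⟨x.1.swap, by simp⟩
  refine DiscreteTopology.of_continuous_injective (f := s) ?_ fun x y hxy => ?_
  · exact Continuous.subtype_mk (continuous_swap.comp continuous_subtype_val) _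
  · exact Subtype.ext (Prod.swap_injective (congrArg Subtype.val hxy))

/-- The transfer of `K₂(·, w)` under the correspondence, evaluated at `z`, is the conjugate of the
transfer of `K₁(·, z)` under the inverse correspondence, evaluated at `w`. So it is holomorphic in
`z` and antiholomorphic in `w`; it is locally bounded by the norm estimates, hence continuous. -/
theorem exists_continuousOn_transfer_kernel (hD₁ : IsPlanarDomain D₁) (hD₂ : IsPlanarDomain D₂)
    (hV : IsProperHolomorphicCorrespondence D₁ D₂ V) (hS : HasBranchesOff D₁ (corrMap V) S p)
    (hS' : HasBranchesOff D₂ (corrInv V) S' q) {K₁ K₂ : ℂ → ℂ → ℂ}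
    (hK₁ : IsReducedBergmanKernel D₁ K₁) (hK₂ : IsReducedBergmanKernel D₂ K₂) :
    ∃ H : ℂ → ℂ → ℂ,
      ContinuousOn (fun x : ℂ × ℂ => H x.1 x.2) (D₁ ×ˢ D₂) ∧
      (∀ w ∈ D₂, DifferentiableOn ℂ (fun z => H z w) D₁) ∧
      (∀ z ∈ D₁, DifferentiableOn ℂ (fun w => conj (H z w)) D₂) ∧
      (∀ w ∈ D₂, IsTransfer (corrMap V) D₁ S p (fun z => K₂ z w) fun z => H z w) ∧
      ∀ z ∈ D₁, IsTransfer (corrInv V) D₂ S' q (fun w => K₁ w z) fun w => conj (H z w) := by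
  have hex₁ : ∀ w, ∃ k : ℂ → ℂ, w ∈ D₂ → k ∈ reducedBergmanSpace D₁ ∧
      IsTransfer (corrMap V) D₁ S p (fun z => K₂ z w) k := by
    intro w
    by_cases hw : w ∈ D₂
    · obtain ⟨k, hk⟩ := exists_isTransfer_mem hD₁ hD₂ hV hS hS' (hK₂ w hw).1
      exact ⟨k, fun _ => hk⟩
    · exact ⟨0, fun h => absurd h hw⟩
  have hex₂ : ∀ z ∈ D₁, ∃ l ∈ reducedBergmanSpace D₂,
      IsTransfer (corrInv V) D₂ S' q (fun w => K₁ w z) l := fun z hz =>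
    exists_isTransfer_mem hD₂ hD₁ hV.swap hS' hS (hK₁ z hz).1
  choose k hk using hex₁
  -- both sides are inner products against kernels, exchanged by adjointness
  have hkl : ∀ z ∈ D₁, ∀ l ∈ reducedBergmanSpace D₂,
      IsTransfer (corrInv V) D₂ S' q (fun w => K₁ w z) l →
      ∀ w ∈ D₂, conj (k w z) = l w := by
    intro z hz l hl hlt w hw
    obtain ⟨h1, h2⟩ := hk w hw
    rw [(hK₁ z hz).2 _ h1, h2.integral_mul_conj_eq hlt hD₁ hD₂ hV hS hS' (hK₂ w hw).1.1
      (hK₁ z hz).1.1 (lintegral_enorm_sq_ne_top (hK₂ w hw).1)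
      (lintegral_enorm_sq_ne_top (hK₁ z hz).1), Complex.conj_conj, (hK₂ w hw).2 _ hl]
  have hanti : ∀ z ∈ D₁, DifferentiableOn ℂ (fun w => conj (k w z)) D₂ := by
    intro z hz
    obtain ⟨l, hl, hlt⟩ := hex₂ z hz
    exact hl.1.congr fun w hw => hkl z hz l hl hlt w hw
  refine ⟨fun z w => k w z, ?_, fun w hw => (hk w hw).1.1, hanti, fun w hw => (hk w hw).2, ?_⟩
  · refine continuousOn_of_differentiableAt_of_continuousAt (hD₁.1.prod hD₂.1)
      (fun x hx => (hk x.2 hx.2).1.1.differentiableAt (hD₁.1.mem_nhds hx.1)) (fun x hx => ?_) ?_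
    · have h1 := ((hanti x.1 hx.1).differentiableAt (hD₂.1.mem_nhds hx.2)).continuousAt
      have h2 := Complex.continuous_conj.continuousAt.comp h1
      simpa only [Function.comp_def, Complex.conj_conj] using h2
    · rintro ⟨z₀, w₀⟩ ⟨hz₀, hw₀⟩
      obtain ⟨R, hR, hRD⟩ := Metric.isOpen_iff.1 hD₁.1 z₀ hz₀
      obtain ⟨r, hr, hrD⟩ := Metric.isOpen_iff.1 hD₂.1 w₀ hw₀
      have hhalf : ∀ (c x : ℂ) (ρ : ℝ), x ∈ Metric.ball c (ρ / 2) →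
          Metric.ball x (ρ / 2) ⊆ Metric.ball c ρ := by
        intro c x ρ hx
        refine Metric.ball_subset_ball' ?_
        rw [Metric.mem_ball] at hx
        linarith
      let C : ℝ := (R / 2) ^ 2 * (r / 2) ^ 2
      have hC : 0 < C := by positivity
      refine ⟨p * q / C + 1, ?_⟩
      filter_upwards [prod_mem_nhds (Metric.ball_mem_nhds z₀ (half_pos hR))
        (Metric.ball_mem_nhds w₀ (half_pos hr))] with x hx
      have hw := hrD (Metric.ball_subset_ball (half_le_self hr.le) hx.2)
      obtain ⟨h1, h2⟩ := hk x.2 hw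
      have e1 := enorm_sq_le_lintegral_of_ball_subset h1.1 (half_pos hR)
        ((hhalf z₀ x.1 R hx.1).trans hRD)
      have e2 := h2.lintegral_enorm_sq_le hD₁ hD₂ hV hS hS' (hK₂ x.2 hw).1.1
      have e3 := hK₂.lintegral_enorm_sq_le (half_pos hr) ((hhalf w₀ x.2 r hx.2).trans hrD)
      have e4 : ENNReal.ofReal C * ‖k x.2 x.1‖ₑ ^ 2 ≤ p * q := by
        calc ENNReal.ofReal C * ‖k x.2 x.1‖ₑ ^ 2
            = ENNReal.ofReal ((r / 2) ^ 2) *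
                (ENNReal.ofReal ((R / 2) ^ 2) * ‖k x.2 x.1‖ₑ ^ 2) := by
              rw [← mul_assoc, ← ENNReal.ofReal_mul (by positivity), mul_comm ((r / 2) ^ 2)]
          _ ≤ ENNReal.ofReal ((r / 2) ^ 2) *
                (p * (q * ∫⁻ w in D₂, ‖K₂ w x.2‖ₑ ^ 2)) := by
              exact mul_le_mul' le_rfl (e1.trans e2)
          _ = p * q * (ENNReal.ofReal ((r / 2) ^ 2) * ∫⁻ w in D₂, ‖K₂ w x.2‖ₑ ^ 2) := by ring
          _ ≤ p * q * 1 := by gcongr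
          _ = p * q := mul_one _
      have e5 : C * ‖k x.2 x.1‖ ^ 2 ≤ p * q := by
        have h3 := ENNReal.toReal_mono
          (ENNReal.mul_ne_top (ENNReal.natCast_ne_top p) (ENNReal.natCast_ne_top q)) e4
        simpa [ENNReal.toReal_ofReal hC.le] using h3
      have e6 : ‖k x.2 x.1‖ ^ 2 ≤ p * q / C := by rwa [le_div_iff₀' hC]
      -- `t ≤ t ^ 2 + 1`
      nlinarith [sq_nonneg (‖k x.2 x.1‖ - 1 / 2)]
  · intro z hz
    obtain ⟨l, hl, hlt⟩ := hex₂ z hz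
    intro w hw F hF
    change conj (k w z) = _
    rw [hkl z hz l hl hlt w hw.1]
    exact hlt w hw F hF

end Formula

theorem theorem1p2 (D₁ D₂ : Set ℂ) (hD₁ : IsPlanarDomain D₁) (hD₂ : IsPlanarDomain D₂)
    (hb₁ : Bornology.IsBounded D₁) (hb₂ : Bornology.IsBounded D₂)
    (V : Set (ℂ × ℂ)) (hV : IsProperHolomorphicCorrespondence D₁ D₂ V) :
    -- the reduced Bergman kernels exist
    IsReducedBergmanKernel D₁ (reducedBergmanKernel D₁) ∧
    IsReducedBergmanKernel D₂ (reducedBergmanKernel D₂) ∧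
    -- branches and inverse branches exist off discrete sets
    (∃ V₁ p, HasBranchesOff D₁ (corrMap V) V₁ p) ∧
    (∃ V₂ q, HasBranchesOff D₂ (corrInv V) V₂ q) ∧
    -- for all choices of the exceptional sets and of the branches, the two sides of the formula
    -- are restrictions of one function `H` on `D₁ × D₂`
    ∀ (V₁ V₂ : Set ℂ) (p q : ℕ),
      HasBranchesOff D₁ (corrMap V) V₁ p → HasBranchesOff D₂ (corrInv V) V₂ q →
      (¬ DiscreteTopology V → 0 < p ∧ 0 < q) ∧
      ∃ H : ℂ → ℂ → ℂ,
        ContinuousOn (fun x : ℂ × ℂ => H x.1 x.2) (D₁ ×ˢ D₂) ∧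
        (∀ w ∈ D₂, DifferentiableOn ℂ (fun z => H z w) D₁) ∧
        (∀ z ∈ D₁, DifferentiableOn ℂ (fun w => conj (H z w)) D₂) ∧
        (∀ z ∈ D₁ \ V₁, ∀ f : Fin p → ℂ → ℂ, IsLocalBranches (corrMap V) z f →
          ∀ w ∈ D₂, H z w = ∑ i, deriv (f i) z * reducedBergmanKernel D₂ (f i z) w) ∧
        (∀ w ∈ D₂ \ V₂, ∀ F : Fin q → ℂ → ℂ, IsLocalBranches (corrInv V) w F →
          ∀ z ∈ D₁, H z w =
            ∑ j, reducedBergmanKernel D₁ z (F j w) * conj (deriv (F j) w)) := by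
  have hK₁ := isReducedBergmanKernel_reducedBergmanKernel hD₁
  have hK₂ := isReducedBergmanKernel_reducedBergmanKernel hD₂
  refine ⟨hK₁, hK₂, hV.exists_hasBranchesOff hD₁ hD₂, hV.swap.exists_hasBranchesOff hD₂ hD₁,
    fun V₁ V₂ p q hS hS' => ⟨fun hd => ⟨hS.pos_of_not_discreteTopology hD₂ hV hd, ?_⟩, ?_⟩⟩
  · exact HasBranchesOff.pos_of_not_discreteTopology (V := Prod.swap ⁻¹' V) hD₁ hV.swap hS'
      fun h => hd (discreteTopology_of_preimage_swap h)
  · obtain ⟨H, hc, hd₁, hd₂, h₁, h₂⟩ :=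
      exists_continuousOn_transfer_kernel hD₁ hD₂ hV hS hS' hK₁ hK₂
    refine ⟨H, hc, hd₁, hd₂, fun z hz f hf w hw => h₁ w hw z hz f hf, fun w hw F hF z hz => ?_⟩
    have h := congrArg conj (h₂ z hz w hw F hF)
    rw [Complex.conj_conj, map_sum] at h
    rw [h]
    refine Finset.sum_congr rfl fun j _ => ?_
    have hFj : F j w ∈ D₁ :=
      (hV.1.1 (IsLocalBranches.mem_corrMap (V := Prod.swap ⁻¹' V) hF j)).1
    rw [map_mul, hK₁.conj_symm hz hFj, mul_comm]
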